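/- Notation. $\mathcal{M}(S)^3$ denotes the $\mathbb{R}^3$-valued (finite, countably additive) Borel measures on $\mathbb{R}^3$ with support in the closed set $S\subset\mathbb{R}^3$. For $\mu\in\mathcal{M}(S)^3$, $|\mu|$ is its total variation measure, $\|\mu\|_{TV}=|\mu|(\mathbb{R}^3)$, $u_\mu=d\mu/d|\mu|$ is the Radon–Nikodym derivative, and $\mu\llcorner E$ is the restriction $B\mapsto\mu(E\cap B)$. We call $\mu$ uni-directional if $u_\mu$ is constant $|\mu|$-a.e.; two uni-directional measures $\mu,\nu$ have the same direction if there is a vector $v$ with $u_\mu=v$ $|\mu|$-a.e. and $u_\nu=v$ $|\nu|$-a.e. (so the zero measure is uni-directional, with every direction). The magnetic field generated by $\mu$ is, with $c=10^{-7}$, $$b(\mu)(x)=-c\left(\int\frac{1}{|x-y|^3}\,d\mu(y)-3\int (x-y)\frac{(x-y)\cdot d\mu(y)}{|x-y|^5}\right),\qquad x\notin\operatorname{supp}\mu,$$ and $\mu,\nu\in\mathcal{M}(S)^3$ are $S$-equivalent if $b(\mu)=b(\nu)$ on $\mathbb{R}^3\setminus S$. A closed set $S\subset\mathbb{R}^3$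 is slender if it has Lebesgue measure zero and each connected component of $\mathbb{R}^3\setminus S$ has infinite Lebesgue measure. Theorem. Let $S=\bigcup_{i=1}^n S_i$ for some pairwise disjoint closed sets $S_1,\dots,S_n$ in $\mathbb{R}^3$, and suppose that $S$ is either compact or slender. Let $\mu\in\mathcal{M}(S)^3$ be such that $\mu_i:=\mu\llcorner S_i$ is uni-directional for $i=1,\dots,n$. If $\nu\in\mathcal{M}(S)^3$ is $S$-equivalent to $\mu$, then $\nu_i:=\nu\llcorner S_i$ and $\mu_i$ are $S_i$-equivalent for $i=1,\dots,n$; moreover $$\|\mu\|_{TV}\le\|\nu\|_{TV},$$ with equality if and only if, for each $i=1,\dots,n$, $\nu_i$ is uni-directional in the same direction as $\mu_i$. Furthermore, if $S$ is slender and equality holds, then $\mu=\nu$. -/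

import Mathlib

open MeasureTheory

noncomputable section

namespace Magnetostatics

/-- Euclidean three-dimensional space, with the Euclidean norm and the Borel σ-algebra. -/
abbrev R3 : Type := EuclideanSpace ℝ (Fin 3)

/-- A magnetization on `ℝ³`: a countably additive `ℝ³`-valued Borel measure (equivalently,
a triple of finite signed Borel measures). -/
abbrev Magnetization : Type := VectorMeasure R3 R3

/-- The space `M(S)³` of magnetizations whose support, i.e. the support of the total variation
measure, lies in `S`. -/
def magnetizationsOn (S : Set R3) : Set Magnetization :=
  {μ | μ.variation.support ⊆ S}

/-- The total variation norm `‖μ‖_TV = |μ|(ℝ³)`. -/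
def tvNorm (μ : Magnetization) : ENNReal := μ.variation Set.univ

/-- The constant `c = 10⁻⁷` (in henries per metre). -/
def magneticConstant : ℝ := 1 / 10 ^ 7

/-- The magnetic field generated by `μ`,
`b(μ)(x) = -c (∫ |x - y|⁻³ dμ(y) - 3 ∫ (x - y) ((x - y) ⬝ dμ(y)) |x - y|⁻⁵)`,
at points `x` outside the support of `μ`. Here `rankOne ℝ z z` is the operator `w ↦ (z ⬝ w) z`,
and the second integral pairs an operator-valued function with the vector measure by evaluation. -/
def magneticField (μ : Magnetization) (x : R3) : R3 :=
  -magneticConstant •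
    ((∫ᵛ y, (1 / ‖x - y‖ ^ 3) ∂[ContinuousLinearMap.lsmul ℝ ℝ; μ]) -
      (3 : ℝ) • ∫ᵛ y, ((1 / ‖x - y‖ ^ 5) • InnerProductSpace.rankOne ℝ (x - y) (x - y))
        ∂[ContinuousLinearMap.id ℝ (R3 →L[ℝ] R3); μ])

/-- `S`-equivalence: the generated magnetic fields agree on `ℝ³ \ S`. -/
def SEquivalent (S : Set R3) (μ ν : Magnetization) : Prop :=
  ∀ x ∉ S, magneticField μ x = magneticField ν x

/-- A closed set is slender if it is Lebesgue-null and each connected component of its complement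
has infinite Lebesgue measure. -/
def IsSlender (S : Set R3) : Prop :=
  IsClosed S ∧ volume S = 0 ∧ ∀ x ∈ Sᶜ, volume (connectedComponentIn Sᶜ x) = ⊤

/-- The `j`-th component of a magnetization, a finite signed measure. -/
def component (μ : Magnetization) (j : Fin 3) : SignedMeasure R3 :=
  μ.mapRange ((EuclideanSpace.proj j : R3 →L[ℝ] ℝ) : R3 →+ ℝ)
    (EuclideanSpace.proj j : R3 →L[ℝ] ℝ).continuous

theorem component_apply (μ : Magnetization) (j : Fin 3) (B : Set R3) :
    component μ j B = μ B j := rfl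

/-- The Radon–Nikodym derivative `u_μ = dμ / d|μ|`, computed componentwise. -/
def polarDensity (μ : Magnetization) (x : R3) : R3 :=
  WithLp.toLp 2 fun j => (component μ j).rnDeriv μ.variation x

/-- `u_μ = v` at `|μ|`-almost every point. (The zero magnetization has every direction.) -/
def HasDirection (μ : Magnetization) (v : R3) : Prop :=
  ∀ᵐ x ∂μ.variation, polarDensity μ x = v

/-- `μ` is uni-directional: `u_μ` is constant `|μ|`-almost everywhere. -/
def IsUniDirectional (μ : Magnetization) : Prop :=
  ∃ v : R3, HasDirection μ v

/-- `μ` and `ν` are both uni-directional, with a common direction. -/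
def IsUniDirectionalSame (μ ν : Magnetization) : Prop :=
  ∃ v : R3, HasDirection μ v ∧ HasDirection ν v

end Magnetostatics

end

noncomputable section
namespace Magnetostatics
open scoped InnerProductSpace ENNReal

/-! ### Magnetizations as densities -/

/-! Let `σ = ν - μ`, a source whose field vanishes off `S`. Everything rests on `silent_restrict`:
each `σ.restrict (T i)` is again silent off `T i`, and its net moment `σ (T i)` is zero. Hence `ν (T
i) = μ (T i)`, and since `μ` has one direction on `T i`, |μ|(T i) = ‖μ (T i)‖ = ‖ν (T i)‖ ≤ |ν|(T
i); summing over `i` gives the inequality. Equality forces ‖ν (T i)‖ = |ν|(T i) for every `i`, the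
equality case of the triangle inequality, which says that `ν` points along `μ (T i)` there
(`variation_eq_iff_isUniDirectionalSame`).

Compact case. A scalar component of the field of the i-th piece is harmonic off `T i`. Near `T i`,
but off it, it equals minus the sum of the fields of the other pieces, which is harmonic across `T
i`. Gluing gives a harmonic function on the whole space that tends to zero at infinity, so it
vanishes by the maximum principle (`field_eq_zero_of_isCompact`). The net moment is read off the
leading term of the far field (`moment_eq_zero_of_isCompact`).

Slender case. The scalar potential of `σ` is constant on each component of the complement. Such a
component has infinite volume while the kernel decays like |z|⁻², so the constant is zero
(`potential_eq_zero_of_const`). As `S` is null, the potential vanishes almost everywhere, and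
pairing it with Laplacians of test functions shows that `σ` has distributional divergence zero. This
condition is local, so it passes to the pieces by a smooth cutoff; testing it on linear functions
gives zero moment, and on dipole potentials zero field. In the equality case `σ` on each piece is
also parallel to a fixed vector; being divergence-free it is then invariant under translation along
that vector, and a finite measure with this property is zero (`IsDivFree.ae_eq_zero_of_direction`).
-/

instance isFiniteMeasure_variation (μ : Magnetization) : IsFiniteMeasure μ.variation := by
  have h : μ.variation ≤ ∑ j, (component μ j).totalVariation := by
    refine VectorMeasure.variation_le_of_forall_enorm_le fun E _ => ?_
    have h1 : ‖μ E‖ₑ ≤ ∑ j, ‖μ E j‖ₑ := by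
      have h2 : μ E = ∑ j, EuclideanSpace.single j (μ E j) := by
        ext i
        simp [Finset.sum_apply]
      calc ‖μ E‖ₑ = ‖∑ j, EuclideanSpace.single j (μ E j)‖ₑ := by rw [← h2]
        _ ≤ ∑ j, ‖EuclideanSpace.single j (μ E j)‖ₑ := enorm_sum_le _ _
        _ = ∑ j, ‖μ E j‖ₑ := by
          refine Finset.sum_congr rfl fun j _ => ?_
          rw [← ofReal_norm, ← ofReal_norm, PiLp.norm_single]
    refine h1.trans ?_
    rw [Measure.finsetSum_apply]
    exact Finset.sum_le_sum fun j _ => (component μ j).enorm_le_totalVariation E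
  exact isFiniteMeasure_of_le _ h

theorem integrable_polarDensity (μ : Magnetization) :
    Integrable (polarDensity μ) μ.variation := by
  have h : ∀ j, Integrable (fun x => polarDensity μ x j) μ.variation := fun j =>
    (component μ j).integrable_rnDeriv μ.variation
  have h2 : polarDensity μ = fun x => ∑ j, EuclideanSpace.single j (polarDensity μ x j) := by
    funext x
    ext i
    simp [Finset.sum_apply]
  rw [h2]
  refine integrable_finsetSum _ fun j _ => ?_
  have h3 := (h j).smul_const (EuclideanSpace.single j (1 : ℝ))
  refine h3.congr (Filter.Eventually.of_forall fun x => ?_)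
  ext i
  simp

theorem setIntegral_apply {m : Measure R3} {f : R3 → R3} (hf : Integrable f m) (B : Set R3)
    (j : Fin 3) : (∫ x in B, f x ∂m) j = ∫ x in B, f x j ∂m :=
  ((EuclideanSpace.proj j : R3 →L[ℝ] ℝ).integral_comp_comm hf.integrableOn).symm

/-- Since ‖μ E‖ ≤ |μ|(E), every component is absolutely continuous with respect to the variation, so
Radon–Nikodym applies coordinate by coordinate. -/
theorem withDensityᵥ_polarDensity (μ : Magnetization) :
    μ.variation.withDensityᵥ (polarDensity μ) = μ := by
  ext B hB : 1
  rw [withDensityᵥ_apply (integrable_polarDensity μ) hB]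
  ext j
  rw [setIntegral_apply (integrable_polarDensity μ)]
  have hac : component μ j ≪ᵥ μ.variation.toENNRealVectorMeasure := by
    refine VectorMeasure.AbsolutelyContinuous.mk fun E hE h0 => ?_
    rw [Measure.toENNRealVectorMeasure_apply_measurable hE] at h0
    have : ‖μ E‖ₑ ≤ 0 := h0 ▸ μ.enorm_measure_le_variation E
    have h1 : μ E = 0 := by simpa using this
    rw [component_apply, h1]
    rfl
  have h2 := (component μ j).withDensityᵥ_rnDeriv_eq μ.variation hac
  have h3 := withDensityᵥ_apply ((component μ j).integrable_rnDeriv μ.variation) hB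
  rw [h2, component_apply] at h3
  rw [h3]
  rfl

theorem apply_eq_setIntegral_polarDensity (μ : Magnetization) {B : Set R3} (hB : MeasurableSet B) :
    μ B = ∫ x in B, polarDensity μ x ∂μ.variation := by
  conv_lhs => rw [← withDensityᵥ_polarDensity μ]
  exact withDensityᵥ_apply (integrable_polarDensity μ) hB

theorem restrict_withDensityᵥ {m : Measure R3} {f : R3 → R3} (hf : Integrable f m) {T : Set R3}
    (hT : MeasurableSet T) :
    (m.withDensityᵥ f).restrict T = (m.restrict T).withDensityᵥ f := by
  ext B hB : 1
  rw [VectorMeasure.restrict_apply _ hT hB, withDensityᵥ_apply hf (hB.inter hT),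
    withDensityᵥ_apply hf.integrableOn hB, Measure.restrict_restrict hB]

/-! ### Directions -/

/-- This trades densities for values on sets, so that directions can be compared between measures
with different variations. -/
theorem hasDirection_iff {μ : Magnetization} {v : R3} :
    HasDirection μ v ↔ ∀ B, MeasurableSet B → μ B = μ.variation.real B • v := by
  constructor
  · intro h B hB
    rw [apply_eq_setIntegral_polarDensity μ hB, integral_congr_ae (ae_restrict_of_ae h)]
    simp
  · intro h
    refine Integrable.ae_eq_of_forall_setIntegral_eq _ _ (integrable_polarDensity μ)
      (integrable_const v) fun B hB _ => ?_
    rw [← apply_eq_setIntegral_polarDensity μ hB, h B hB]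
    simp

theorem norm_eq_one_of_hasDirection {μ : Magnetization} {v : R3} (h : HasDirection μ v)
    (h0 : μ.variation.real Set.univ ≠ 0) : ‖v‖ = 1 := by
  have h1 := Measure.variation_withDensityᵥ (integrable_polarDensity μ)
  rw [withDensityᵥ_polarDensity] at h1
  have h2 : μ.variation Set.univ = ‖v‖ₑ * μ.variation Set.univ := by
    conv_lhs => rw [h1]
    rw [withDensity_apply _ MeasurableSet.univ, Measure.restrict_univ,
      lintegral_congr_ae (h.mono fun x hx => by rw [hx])]
    simp
  have h3 : μ.variation.real Set.univ = ‖v‖ * μ.variation.real Set.univ := by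
    have := congrArg ENNReal.toReal h2
    rwa [ENNReal.toReal_mul, toReal_enorm] at this
  exact mul_right_cancel₀ h0 (by rw [← h3, one_mul])

theorem norm_apply_le (μ : Magnetization) (B : Set R3) : ‖μ B‖ ≤ μ.variation.real B :=
  VectorMeasure.norm_measure_le_variation

/-- The inequality ⟪v, μ B⟫ ≤ |μ|(B) holds for a set and for its complement, and the two add up to
an equality. So each is an equality, and the equality case of Cauchy–Schwarz gives `μ B` as a
multiple of `v`. -/
theorem hasDirection_of_inner_eq {μ : Magnetization} {v : R3} (hv : ‖v‖ = 1)
    (h : ⟪v, μ Set.univ⟫_ℝ = μ.variation.real Set.univ) : HasDirection μ v := by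
  have hle : ∀ B, ⟪v, μ B⟫_ℝ ≤ μ.variation.real B := fun B =>
    (real_inner_le_norm _ _).trans (by rw [hv, one_mul]; exact norm_apply_le μ B)
  refine hasDirection_iff.2 fun B hB => ?_
  have h1 : μ Set.univ = μ B + μ Bᶜ := by
    rw [← VectorMeasure.of_union disjoint_compl_right hB hB.compl, Set.union_compl_self]
  have h2 : μ.variation.real Set.univ = μ.variation.real B + μ.variation.real Bᶜ :=
    (measureReal_add_measureReal_compl hB).symm
  have h3 : ⟪v, μ B⟫_ℝ = μ.variation.real B := by
    rw [h1, h2, inner_add_right] at h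
    linarith [hle B, hle Bᶜ]
  have h4 : ‖μ B‖ = μ.variation.real B :=
    le_antisymm (norm_apply_le μ B) (h3 ▸ (real_inner_le_norm _ _).trans (by rw [hv, one_mul]))
  have h5 := (inner_eq_norm_mul_iff_real (x := v) (y := μ B)).1 (by rw [h3, hv, h4, one_mul])
  rw [hv, one_smul, h4] at h5
  exact h5.symm

theorem hasDirection_of_variation_eq_zero {μ : Magnetization}
    (h : μ.variation.real Set.univ = 0) (v : R3) : HasDirection μ v := by
  have : μ.variation = 0 := by
    rw [← Measure.measure_univ_eq_zero]
    exact (measureReal_eq_zero_iff (measure_ne_top _ _)).1 h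
  simp [HasDirection, this]

/-! ### The field as an integral of a scalar kernel -/

theorem norm_polarDensity (μ : Magnetization) : ∀ᵐ x ∂μ.variation, ‖polarDensity μ x‖ = 1 := by
  have h1 := Measure.variation_withDensityᵥ (integrable_polarDensity μ)
  rw [withDensityᵥ_polarDensity] at h1
  have h2 : μ.variation.withDensity (fun x => ‖polarDensity μ x‖ₑ)
      = μ.variation.withDensity (fun _ => 1) := by
    rw [← h1]; exact withDensity_one.symm
  have h3 := (withDensity_eq_iff_of_sigmaFinite
    (integrable_polarDensity μ).aestronglyMeasurable.enorm aemeasurable_const).1 h2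
  filter_upwards [h3] with x hx
  rw [← toReal_enorm, hx]
  rfl

theorem norm_pairing_le {E G : Type*} [NormedAddCommGroup E] [NormedSpace ℝ E]
    [NormedAddCommGroup G] [NormedSpace ℝ G] (μ : Magnetization) (B : E →L[ℝ] R3 →L[ℝ] G)
    (g : R3 → E) :
    ∀ᵐ x ∂μ.variation, ‖B (g x) (polarDensity μ x)‖ ≤ ‖B‖ * ‖g x‖ := by
  filter_upwards [norm_polarDensity μ] with x hx
  simpa [hx] using B.le_opNorm₂ (g x) (polarDensity μ x)

theorem integrable_pairing {E G : Type*} [NormedAddCommGroup E] [NormedSpace ℝ E]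
    [NormedAddCommGroup G] [NormedSpace ℝ G] (μ : Magnetization) (B : E →L[ℝ] R3 →L[ℝ] G)
    {g : R3 → E} (hg : Integrable g μ.variation) :
    Integrable (fun y => B (g y) (polarDensity μ y)) μ.variation :=
  (hg.norm.const_mul ‖B‖).mono'
    (B.aestronglyMeasurable_comp₂ hg.1 (integrable_polarDensity μ).1) (norm_pairing_le μ B g)

/-- Turns integrals against a vector measure into Bochner integrals, where Fubini, dominated
convergence and differentiation under the integral apply. Both sides are continuous in `g` for the
L¹ norm, because the polar density has norm one, so indicators suffice. -/
theorem vectorIntegral_eq {E G : Type*} [NormedAddCommGroup E] [NormedSpace ℝ E]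
    [NormedAddCommGroup G] [NormedSpace ℝ G] [CompleteSpace G] (μ : Magnetization)
    (B : E →L[ℝ] R3 →L[ℝ] G) {g : R3 → E} (hg : Integrable g μ.variation) :
    ∫ᵛ y, g y ∂[B; μ] = ∫ y, B (g y) (polarDensity μ y) ∂μ.variation := by
  refine Integrable.induction (P := fun g => ∫ᵛ y, g y ∂[B; μ]
    = ∫ y, B (g y) (polarDensity μ y) ∂μ.variation) ?_ ?_ ?_ ?_ hg
  · intro c s hs _
    rw [VectorMeasure.integral_indicator_const c hs, apply_eq_setIntegral_polarDensity μ hs,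
      ← (B c).integral_comp_comm (integrable_polarDensity μ).integrableOn, ← integral_indicator hs]
    congr 1
    funext x
    by_cases hx : x ∈ s <;> simp [hx]
  · intro g h _ hg hh ihg ihh
    rw [VectorMeasure.integral_add hg hh, ihg, ihh,
      ← integral_add (integrable_pairing μ B hg) (integrable_pairing μ B hh)]
    simp
  · refine isClosed_eq VectorMeasure.continuous_integral ?_
    refine LipschitzWith.continuous (K := ‖B‖₊) (LipschitzWith.of_dist_le_mul fun g h => ?_)
    have ig := L1.integrable_coeFn g
    have ih := L1.integrable_coeFn h
    rw [dist_eq_norm, ← integral_sub (integrable_pairing μ B ig) (integrable_pairing μ B ih),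
      dist_eq_norm, L1.norm_eq_integral_norm, coe_nnnorm, ← integral_const_mul]
    refine norm_integral_le_of_norm_le ((L1.integrable_coeFn (g - h)).norm.const_mul _) ?_
    filter_upwards [norm_pairing_le μ B (fun x => g x - h x), Lp.coeFn_sub g h] with x hx hs
    rw [hs]
    simpa using hx
  · intro g h hgh _ ih
    rw [← VectorMeasure.integral_congr_ae hgh, ih]
    exact integral_congr_ae (hgh.mono fun x hx => by simp only [hx])

theorem polarDensity_restrict (μ : Magnetization) {T : Set R3} (hT : MeasurableSet T) :
    polarDensity (μ.restrict T) =ᵐ[μ.variation.restrict T] polarDensity μ := by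
  have h1 := integrable_polarDensity (μ.restrict T)
  have h2 := withDensityᵥ_polarDensity (μ.restrict T)
  rw [VectorMeasure.variation_restrict hT] at h1 h2
  refine h1.ae_eq_of_withDensityᵥ_eq (integrable_polarDensity μ).integrableOn ?_
  rw [h2, ← restrict_withDensityᵥ (integrable_polarDensity μ) hT, withDensityᵥ_polarDensity]

/-- The potential at displacement `z` of a dipole with moment `w`. -/
def potentialKernel (z w : R3) : ℝ := ⟪z, w⟫_ℝ / ‖z‖ ^ 3

/-- The derivative of the potential of a dipole with moment `w` in the direction `e`. -/
def fieldKernel (e z w : R3) : ℝ := ⟪e, w⟫_ℝ / ‖z‖ ^ 3 - 3 * (⟪z, w⟫_ℝ * ⟪z, e⟫_ℝ / ‖z‖ ^ 5)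

theorem exists_le_norm_sub_of_notMem {T : Set R3} (hT : IsClosed T) {x : R3} (hx : x ∉ T) :
    ∃ δ > 0, ∀ y ∈ T, δ ≤ ‖x - y‖ := by
  obtain ⟨δ, hδ, h⟩ := Metric.isOpen_iff.1 hT.isOpen_compl x hx
  refine ⟨δ, hδ, fun y hy => ?_⟩
  by_contra hlt
  exact h (by rw [Metric.mem_ball, dist_comm, dist_eq_norm]; exact not_le.1 hlt) hy

theorem integrable_fieldIntegrands {m : Measure R3} [IsFiniteMeasure m] {T : Set R3}
    (hT : IsClosed T) (hm : m Tᶜ = 0) {x : R3} (hx : x ∉ T) :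
    Integrable (fun y => 1 / ‖x - y‖ ^ 3) m ∧
    Integrable (fun y => (1 / ‖x - y‖ ^ 5) • InnerProductSpace.rankOne ℝ (x - y) (x - y)) m := by
  obtain ⟨δ, hδ, h⟩ := exists_le_norm_sub_of_notMem hT hx
  have hae : ∀ᵐ y ∂m, y ∈ T := hm
  constructor
  · refine Integrable.of_bound (Measurable.aestronglyMeasurable (by fun_prop)) (1 / δ ^ 3) ?_
    filter_upwards [hae] with y hy
    have := h y hy
    rw [Real.norm_of_nonneg (by positivity)]
    gcongr
  · refine Integrable.of_bound (C := 1 / δ ^ 3) ?_ ?_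
    · have hs : Measurable fun y : R3 => 1 / ‖x - y‖ ^ 5 := by fun_prop
      have hr : Continuous fun y : R3 => InnerProductSpace.rankOne ℝ (x - y) (x - y) :=
        ((InnerProductSpace.rankOne ℝ).continuous.comp (continuous_sub_left x)).clm_apply
          (continuous_sub_left x)
      exact hs.aestronglyMeasurable.smul hr.aestronglyMeasurable
    · filter_upwards [hae] with y hy
      have h1 := h y hy
      have h0 : 0 < ‖x - y‖ := hδ.trans_le h1
      rw [norm_smul, InnerProductSpace.norm_rankOne, Real.norm_of_nonneg (by positivity)]
      calc 1 / ‖x - y‖ ^ 5 * (‖x - y‖ * ‖x - y‖) = 1 / ‖x - y‖ ^ 3 := by field_simp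
        _ ≤ 1 / δ ^ 3 := by gcongr

/-- Pairing with a fixed vector makes the field a scalar integral. The kernel is the derivative
along `e` of the dipole potential, so the field is a constant multiple of a gradient. -/
theorem inner_magneticField {μ : Magnetization} {T : Set R3} (hT : IsClosed T)
    (hm : μ.variation Tᶜ = 0) {x : R3} (hx : x ∉ T) (e : R3) :
    ⟪e, magneticField μ x⟫_ℝ
      = -magneticConstant * ∫ y, fieldKernel e (x - y) (polarDensity μ y) ∂μ.variation := by
  obtain ⟨h1, h2⟩ := integrable_fieldIntegrands hT hm hx
  have i1 := integrable_pairing μ (ContinuousLinearMap.lsmul ℝ ℝ) h1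
  have i2 := integrable_pairing μ (ContinuousLinearMap.id ℝ (R3 →L[ℝ] R3)) h2
  rw [magneticField, vectorIntegral_eq μ _ h1, vectorIntegral_eq μ _ h2, inner_smul_right,
    inner_sub_right, inner_smul_right, ← integral_inner i1, ← integral_inner i2,
    ← integral_const_mul, ← integral_sub (i1.const_inner e) ((i2.const_inner e).const_mul 3)]
  congr 2
  funext y
  simp only [fieldKernel, ContinuousLinearMap.lsmul_apply, inner_smul_right,
    ContinuousLinearMap.id_apply, smul_apply, InnerProductSpace.rankOne_apply]
  rw [real_inner_comm (x - y) e]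
  ring

theorem magneticField_sub {μ ν : Magnetization} {T : Set R3} (hT : IsClosed T)
    (hμ : μ.variation Tᶜ = 0) (hν : ν.variation Tᶜ = 0) {x : R3} (hx : x ∉ T) :
    magneticField (μ - ν) x = magneticField μ x - magneticField ν x := by
  obtain ⟨h1, h2⟩ := integrable_fieldIntegrands hT hμ hx
  obtain ⟨h3, h4⟩ := integrable_fieldIntegrands hT hν hx
  rw [magneticField, VectorMeasure.integral_sub_vectorMeasure h1 h3,
    VectorMeasure.integral_sub_vectorMeasure h2 h4, magneticField, magneticField, ← smul_sub]
  congr 1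
  rw [smul_sub]
  abel

theorem magneticField_restrict_eq_zero_iff {μ : Magnetization} {T : Set R3} (hT : IsClosed T)
    {x : R3} (hx : x ∉ T) :
    magneticField (μ.restrict T) x = 0 ↔
      ∀ e, ∫ y in T, fieldKernel e (x - y) (polarDensity μ y) ∂μ.variation = 0 := by
  have hm : (μ.restrict T).variation Tᶜ = 0 := by
    rw [VectorMeasure.variation_restrict hT.measurableSet,
      Measure.restrict_apply hT.measurableSet.compl]
    simp
  have hc : -magneticConstant ≠ 0 := by norm_num [magneticConstant]
  have key : ∀ e, ⟪e, magneticField (μ.restrict T) x⟫_ℝ = -magneticConstant *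
      ∫ y in T, fieldKernel e (x - y) (polarDensity μ y) ∂μ.variation := fun e => by
    rw [inner_magneticField hT hm hx, VectorMeasure.variation_restrict hT.measurableSet]
    congr 1
    exact integral_congr_ae ((polarDensity_restrict μ hT.measurableSet).mono
      fun y hy => by simp only [hy])
  constructor
  · intro h e
    have := key e
    rw [h, inner_zero_right] at this
    exact (mul_eq_zero.1 this.symm).resolve_left hc
  · intro h
    refine ext_inner_left ℝ fun e => ?_
    rw [key, h e, mul_zero, inner_zero_right]

end Magnetostatics
end

noncomputable section
namespace Magnetostatics
open scoped InnerProductSpace ENNReal Topology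
open Filter

/-! ### Kernels and their derivatives along lines -/

/-- A scalar function bounded away from the origin. -/
def BddOffZero (g : R3 → ℝ) : Prop := ∀ δ > 0, ∃ C, ∀ z, δ ≤ ‖z‖ → |g z| ≤ C

/-- A kernel bounded, away from the origin, by a multiple of the norm of the moment. -/
def KernelBdd (k : R3 → R3 → ℝ) : Prop :=
  ∀ δ > 0, ∃ C, ∀ z w, δ ≤ ‖z‖ → |k z w| ≤ C * ‖w‖

/-- These closure rules let each kernel bound be read off a factorization into powers of 1/‖z‖, the
bounded factors ⟪z, e⟫/‖z‖, and one factor linear in the moment. -/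
theorem BddOffZero.mul {g h : R3 → ℝ} (hg : BddOffZero g) (hh : BddOffZero h) :
    BddOffZero fun z => g z * h z := by
  intro δ hδ
  obtain ⟨C, hC⟩ := hg δ hδ
  obtain ⟨D, hD⟩ := hh δ hδ
  refine ⟨C * D, fun z hz => ?_⟩
  rw [abs_mul]
  exact mul_le_mul (hC z hz) (hD z hz) (abs_nonneg _) ((abs_nonneg _).trans (hC z hz))

theorem BddOffZero.pow {g : R3 → ℝ} (hg : BddOffZero g) (n : ℕ) :
    BddOffZero fun z => g z ^ n := by
  intro δ hδ
  obtain ⟨C, hC⟩ := hg δ hδ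
  refine ⟨C ^ n, fun z hz => ?_⟩
  rw [abs_pow]
  exact pow_le_pow_left₀ (abs_nonneg _) (hC z hz) n

theorem bddOffZero_const (c : ℝ) : BddOffZero fun _ => c := fun _ _ => ⟨|c|, fun _ _ => le_rfl⟩

theorem bddOffZero_inv_norm : BddOffZero fun z => 1 / ‖z‖ := fun δ hδ => ⟨1 / δ, fun z hz => by
  rw [abs_of_nonneg (by positivity)]
  exact one_div_le_one_div_of_le hδ hz⟩

theorem abs_inner_div_norm_le (z w : R3) : |⟪z, w⟫_ℝ / ‖z‖| ≤ ‖w‖ := by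
  rcases eq_or_ne z 0 with rfl | hz
  · simp
  · rw [abs_div, abs_norm, div_le_iff₀ (norm_pos_iff.2 hz), mul_comm]
    exact abs_real_inner_le_norm z w

theorem bddOffZero_inner_div_norm (e : R3) : BddOffZero fun z => ⟪z, e⟫_ℝ / ‖z‖ := fun _ _ =>
  ⟨‖e‖, fun z _ => abs_inner_div_norm_le z e⟩

theorem kernelBdd_inner_div_norm : KernelBdd fun z w => ⟪z, w⟫_ℝ / ‖z‖ := fun _ _ =>
  ⟨1, fun z w _ => by rw [one_mul]; exact abs_inner_div_norm_le z w⟩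

theorem kernelBdd_inner_const (e : R3) : KernelBdd fun _ w => ⟪e, w⟫_ℝ := fun _ _ =>
  ⟨‖e‖, fun _ w _ => abs_real_inner_le_norm e w⟩

theorem BddOffZero.mul_kernel {g : R3 → ℝ} {k : R3 → R3 → ℝ} (hg : BddOffZero g)
    (hk : KernelBdd k) : KernelBdd fun z w => g z * k z w := by
  intro δ hδ
  obtain ⟨C, hC⟩ := hg δ hδ
  obtain ⟨D, hD⟩ := hk δ hδ
  refine ⟨C * D, fun z w hz => ?_⟩
  rw [abs_mul, mul_assoc]
  exact mul_le_mul (hC z hz) (hD z w hz) (abs_nonneg _) ((abs_nonneg _).trans (hC z hz))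

theorem KernelBdd.add {k l : R3 → R3 → ℝ} (hk : KernelBdd k) (hl : KernelBdd l) :
    KernelBdd fun z w => k z w + l z w := by
  intro δ hδ
  obtain ⟨C, hC⟩ := hk δ hδ
  obtain ⟨D, hD⟩ := hl δ hδ
  refine ⟨C + D, fun z w hz => ?_⟩
  rw [add_mul]
  exact (abs_add_le _ _).trans (add_le_add (hC z w hz) (hD z w hz))

theorem KernelBdd.congr {k l : R3 → R3 → ℝ} (hk : KernelBdd k)
    (h : ∀ z w, z ≠ 0 → l z w = k z w) : KernelBdd l := by
  intro δ hδ
  obtain ⟨C, hC⟩ := hk δ hδ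
  refine ⟨C, fun z w hz => ?_⟩
  rw [h z w (norm_pos_iff.1 (hδ.trans_le hz))]
  exact hC z w hz

/-- The derivative of `fieldKernel e` in the direction `a`. -/
def fieldKernelDeriv (e a z w : R3) : ℝ :=
  -3 * (⟪e, w⟫_ℝ * ⟪z, a⟫_ℝ / ‖z‖ ^ 5)
    - 3 * ((⟪a, w⟫_ℝ * ⟪z, e⟫_ℝ + ⟪z, w⟫_ℝ * ⟪a, e⟫_ℝ) / ‖z‖ ^ 5)
    + 15 * (⟪z, w⟫_ℝ * ⟪z, e⟫_ℝ * ⟪z, a⟫_ℝ / ‖z‖ ^ 7)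

/-- The second derivative of `fieldKernel e` in the direction `a`. -/
def fieldKernelDeriv₂ (e a z w : R3) : ℝ :=
  -3 * (⟪e, w⟫_ℝ * ⟪a, a⟫_ℝ / ‖z‖ ^ 5) + 15 * (⟪e, w⟫_ℝ * ⟪z, a⟫_ℝ ^ 2 / ‖z‖ ^ 7)
    - 6 * (⟪a, w⟫_ℝ * ⟪a, e⟫_ℝ / ‖z‖ ^ 5)
    + 30 * ((⟪a, w⟫_ℝ * ⟪z, e⟫_ℝ + ⟪z, w⟫_ℝ * ⟪a, e⟫_ℝ) * ⟪z, a⟫_ℝ / ‖z‖ ^ 7)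
    + 15 * (⟪z, w⟫_ℝ * ⟪z, e⟫_ℝ * ⟪a, a⟫_ℝ / ‖z‖ ^ 7)
    - 105 * (⟪z, w⟫_ℝ * ⟪z, e⟫_ℝ * ⟪z, a⟫_ℝ ^ 2 / ‖z‖ ^ 9)

theorem kernelBdd_potentialKernel : KernelBdd potentialKernel := by
  refine ((bddOffZero_inv_norm.pow 2).mul_kernel kernelBdd_inner_div_norm).congr
    fun z w hz => ?_
  have := norm_ne_zero_iff.2 hz
  simp only [potentialKernel]
  field_simp

theorem kernelBdd_fieldKernel (e : R3) : KernelBdd (fieldKernel e) := by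
  refine (((bddOffZero_inv_norm.pow 3).mul_kernel (kernelBdd_inner_const e)).add
    ((((bddOffZero_const (-3)).mul (bddOffZero_inv_norm.pow 3)).mul
      (bddOffZero_inner_div_norm e)).mul_kernel kernelBdd_inner_div_norm)).congr fun z w hz => ?_
  have := norm_ne_zero_iff.2 hz
  simp only [fieldKernel]
  field_simp
  ring

theorem kernelBdd_fieldKernelDeriv (e a : R3) : KernelBdd (fieldKernelDeriv e a) := by
  have p := bddOffZero_inv_norm.pow 4
  have q := bddOffZero_inner_div_norm
  refine ((((p.mul ((bddOffZero_const (-3)).mul (q a))).mul_kernel (kernelBdd_inner_const e)).add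
    ((p.mul ((bddOffZero_const (-3)).mul (q e))).mul_kernel (kernelBdd_inner_const a))).add
    (((p.mul (bddOffZero_const (-3 * ⟪a, e⟫_ℝ))).mul_kernel kernelBdd_inner_div_norm).add
    ((p.mul ((bddOffZero_const 15).mul ((q e).mul (q a)))).mul_kernel
      kernelBdd_inner_div_norm))).congr fun z w hz => ?_
  have := norm_ne_zero_iff.2 hz
  simp only [fieldKernelDeriv]
  field_simp
  ring

theorem kernelBdd_fieldKernelDeriv₂ (e a : R3) : KernelBdd (fieldKernelDeriv₂ e a) := by
  have p := bddOffZero_inv_norm.pow 5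
  have q := bddOffZero_inner_div_norm
  have c := bddOffZero_const
  refine ((((p.mul (c (-3 * ⟪a, a⟫_ℝ))).mul_kernel (kernelBdd_inner_const e)).add
    ((p.mul ((c 15).mul ((q a).pow 2))).mul_kernel (kernelBdd_inner_const e))).add
    ((((p.mul (c (-6 * ⟪a, e⟫_ℝ))).mul_kernel (kernelBdd_inner_const a)).add
    ((p.mul ((c 30).mul ((q e).mul (q a)))).mul_kernel (kernelBdd_inner_const a))).add
    ((((p.mul ((c (30 * ⟪a, e⟫_ℝ)).mul (q a))).mul_kernel kernelBdd_inner_div_norm).add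
    ((p.mul ((c (15 * ⟪a, a⟫_ℝ)).mul (q e))).mul_kernel kernelBdd_inner_div_norm)).add
    ((p.mul ((c (-105)).mul ((q e).mul ((q a).pow 2)))).mul_kernel
      kernelBdd_inner_div_norm)))).congr fun z w hz => ?_
  have := norm_ne_zero_iff.2 hz
  simp only [fieldKernelDeriv₂]
  field_simp
  ring

theorem measurable_potentialKernel : Measurable fun p : R3 × R3 => potentialKernel p.1 p.2 := by
  unfold potentialKernel
  fun_prop

theorem measurable_fieldKernel (e : R3) : Measurable fun p : R3 × R3 => fieldKernel e p.1 p.2 := by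
  unfold fieldKernel
  fun_prop

theorem measurable_fieldKernelDeriv (e a : R3) :
    Measurable fun p : R3 × R3 => fieldKernelDeriv e a p.1 p.2 := by
  unfold fieldKernelDeriv
  fun_prop

theorem measurable_fieldKernelDeriv₂ (e a : R3) :
    Measurable fun p : R3 × R3 => fieldKernelDeriv₂ e a p.1 p.2 := by
  unfold fieldKernelDeriv₂
  fun_prop

theorem hasDerivAt_line (z a : R3) : HasDerivAt (fun t : ℝ => z + t • a) a 0 := by
  simpa using ((hasDerivAt_id (0 : ℝ)).smul_const a).const_add z

theorem hasDerivAt_line_inner (z a w : R3) :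
    HasDerivAt (fun t : ℝ => ⟪z + t • a, w⟫_ℝ) ⟪a, w⟫_ℝ 0 := by
  simpa using (hasDerivAt_line z a).inner ℝ (hasDerivAt_const 0 w)

theorem hasDerivAt_line_norm {z : R3} (hz : z ≠ 0) (a : R3) :
    HasDerivAt (fun t : ℝ => ‖z + t • a‖) (⟪z, a⟫_ℝ / ‖z‖) 0 := by
  have h := ((hasDerivAt_line z a).norm_sq).sqrt (by simpa using hz)
  simp only [Real.sqrt_sq (norm_nonneg _), zero_smul, add_zero] at h
  refine h.congr_deriv ?_
  have := norm_ne_zero_iff.2 hz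
  field_simp

theorem hasDerivAt_potentialKernel {z : R3} (hz : z ≠ 0) (a w : R3) :
    HasDerivAt (fun t : ℝ => potentialKernel (z + t • a) w) (fieldKernel a z w) 0 := by
  have hn := norm_ne_zero_iff.2 hz
  refine ((hasDerivAt_line_inner z a w).div ((hasDerivAt_line_norm hz a).pow 3)
    (by simpa using hz)).congr_deriv ?_
  simp only [fieldKernel, zero_smul, add_zero, Nat.cast_ofNat, Pi.pow_apply]
  field_simp
  ring

theorem hasDerivAt_fieldKernel {z : R3} (hz : z ≠ 0) (e a w : R3) :
    HasDerivAt (fun t : ℝ => fieldKernel e (z + t • a) w) (fieldKernelDeriv e a z w) 0 := by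
  have hn := norm_ne_zero_iff.2 hz
  have r := hasDerivAt_line_norm hz a
  have i := hasDerivAt_line_inner z a
  refine (((hasDerivAt_const (0 : ℝ) ⟪e, w⟫_ℝ).div (r.pow 3) (by simpa using hz)).sub
    ((((i w).mul (i e)).div (r.pow 5) (by simpa using hz)).const_mul 3)).congr_deriv ?_
  simp only [fieldKernelDeriv, zero_smul, add_zero, Nat.cast_ofNat, Pi.mul_apply, Pi.pow_apply]
  field_simp
  ring

theorem hasDerivAt_fieldKernelDeriv {z : R3} (hz : z ≠ 0) (e a w : R3) :
    HasDerivAt (fun t : ℝ => fieldKernelDeriv e a (z + t • a) w)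
      (fieldKernelDeriv₂ e a z w) 0 := by
  have hn := norm_ne_zero_iff.2 hz
  have r := hasDerivAt_line_norm hz a
  have i := hasDerivAt_line_inner z a
  have h0 : ‖z + (0 : ℝ) • a‖ ≠ 0 := by simpa using hz
  refine ((((((i a).const_mul ⟪e, w⟫_ℝ).div (r.pow 5) (pow_ne_zero _ h0)).const_mul (-3)).sub
    (((((i e).const_mul ⟪a, w⟫_ℝ).add ((i w).mul_const ⟪a, e⟫_ℝ)).div (r.pow 5)
      (pow_ne_zero _ h0)).const_mul 3)).add
    (((((i w).mul (i e)).mul (i a)).div (r.pow 7) (pow_ne_zero _ h0)).const_mul 15)).congr_deriv ?_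
  simp only [fieldKernelDeriv₂, zero_smul, add_zero, Nat.cast_ofNat, Pi.mul_apply, Pi.pow_apply,
    Pi.add_apply]
  field_simp
  ring

/-- Harmonicity of the field kernel away from the origin. -/
theorem sum_fieldKernelDeriv₂ (b : OrthonormalBasis (Fin 3) ℝ R3) {z : R3} (hz : z ≠ 0)
    (e w : R3) : ∑ l, fieldKernelDeriv₂ e (b l) z w = 0 := by
  have hn := norm_ne_zero_iff.2 hz
  have s : ∀ u v : R3, ⟪b 0, u⟫_ℝ * ⟪b 0, v⟫_ℝ + ⟪b 1, u⟫_ℝ * ⟪b 1, v⟫_ℝ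
      + ⟪b 2, u⟫_ℝ * ⟪b 2, v⟫_ℝ = ⟪u, v⟫_ℝ := fun u v => by
    rw [← b.sum_inner_mul_inner u v, Fin.sum_univ_three]
    simp only [real_inner_comm]
  have n : ∀ l, ⟪b l, b l⟫_ℝ = 1 := fun l => by
    rw [real_inner_self_eq_norm_sq, b.norm_eq_one]; norm_num
  have hzz := s z z
  rw [real_inner_self_eq_norm_sq] at hzz
  have hze := s z e
  have hzw := s z w
  have hew := s w e
  rw [real_inner_comm e w] at hew
  rw [Fin.sum_univ_three]
  simp only [fieldKernelDeriv₂, n]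
  rw [real_inner_comm (b 0) z, real_inner_comm (b 1) z, real_inner_comm (b 2) z]
  generalize ⟪b 0, z⟫_ℝ = z0 at *
  generalize ⟪b 1, z⟫_ℝ = z1 at *
  generalize ⟪b 2, z⟫_ℝ = z2 at *
  generalize ⟪b 0, w⟫_ℝ = w0 at *
  generalize ⟪b 1, w⟫_ℝ = w1 at *
  generalize ⟪b 2, w⟫_ℝ = w2 at *
  generalize ⟪b 0, e⟫_ℝ = e0 at *
  generalize ⟪b 1, e⟫_ℝ = e1 at *
  generalize ⟪b 2, e⟫_ℝ = e2 at *
  generalize ‖z‖ = r at *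
  generalize ⟪z, e⟫_ℝ = ze at *
  generalize ⟪z, w⟫_ℝ = zw at *
  generalize ⟪e, w⟫_ℝ = ew at *
  set W := w0 * e0 + w1 * e1 + w2 * e2 with hW
  set Z := z0 * z0 + z1 * z1 + z2 * z2 with hZ
  set P := z0 * e0 + z1 * e1 + z2 * e2 with hP
  set Q := z0 * w0 + z1 * w1 + z2 * w2 with hQ
  -- By Parseval `W`, `Z`, `P`, `Q` equal ⟪e, w⟫, ‖z‖², ⟪z, e⟫, ⟪z, w⟫. The terms in ⟪e, w⟫ then
  -- cancel as -9 - 6 + 15, the others as 2·30 + 45 - 105.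
  have key : ∀ A : ℝ, A = ((-9 * ew - 6 * W) * r ^ 4 + (15 * ew * Z + 30 * (Q * ze + zw * P)
      + 45 * zw * ze) * r ^ 2 - 105 * zw * ze * Z) / r ^ 9 → A = 0 := fun A h => by
    rw [h, hew, hzz, hze, hzw]
    field_simp
    ring
  refine key _ ?_
  rw [hW, hZ, hP, hQ]
  field_simp
  ring

/-! ### Differentiation under the integral sign -/

theorem integrable_kernel {k : R3 → R3 → ℝ} (hk : KernelBdd k)
    (hkm : Measurable fun p : R3 × R3 => k p.1 p.2) {m : Measure R3} {f : R3 → R3}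
    (hf : Integrable f m) {T : Set R3} (hT : IsClosed T) (hm : m Tᶜ = 0) {x : R3} (hx : x ∉ T) :
    Integrable (fun y => k (x - y) (f y)) m := by
  obtain ⟨δ, hδ, h⟩ := exists_le_norm_sub_of_notMem hT hx
  obtain ⟨C, hC⟩ := hk δ hδ
  refine (hf.norm.const_mul C).mono' ?_ ?_
  · exact (hkm.comp_aemeasurable ((measurable_const.sub measurable_id).aemeasurable.prodMk
      hf.1.aemeasurable)).aestronglyMeasurable
  · have hae : ∀ᵐ y ∂m, y ∈ T := hm
    filter_upwards [hae] with y hy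
    exact hC _ _ (h y hy)

theorem hasDerivAt_shift {F : R3 → ℝ} {x a : R3} {t D : ℝ}
    (h : HasDerivAt (fun s : ℝ => F (x + t • a + s • a)) D 0) :
    HasDerivAt (fun s : ℝ => F (x + s • a)) D t := by
  have h1 : HasDerivAt (fun s : ℝ => F (x + t • a + s • a)) D (t - t) := by rwa [sub_self]
  refine (h1.comp_sub_const t t).congr_of_eventuallyEq (Eventually.of_forall fun s => ?_)
  simp only
  congr 1
  rw [sub_smul]
  abel

theorem hasDerivAt_integral_kernel {k k' : R3 → R3 → ℝ} (hk : KernelBdd k)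
    (hkm : Measurable fun p : R3 × R3 => k p.1 p.2) (hk' : KernelBdd k')
    (hkm' : Measurable fun p : R3 × R3 => k' p.1 p.2) {a : R3}
    (hd : ∀ z ≠ 0, ∀ w, HasDerivAt (fun t : ℝ => k (z + t • a) w) (k' z w) 0)
    {m : Measure R3} {f : R3 → R3} (hf : Integrable f m) {T : Set R3} (hT : IsClosed T)
    (hm : m Tᶜ = 0) {x : R3} (hx : x ∉ T) :
    HasDerivAt (fun t : ℝ => ∫ y, k (x + t • a - y) (f y) ∂m) (∫ y, k' (x - y) (f y) ∂m) 0 := by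
  obtain ⟨δ, hδ, h⟩ := exists_le_norm_sub_of_notMem hT hx
  -- Half of the distance to `T` is given up so that `x` may move by less than `δ / 2` and the
  -- derivative kernel stays dominated.
  obtain ⟨C, hC⟩ := hk' (δ / 2) (by positivity)
  have hc : Tendsto (fun t : ℝ => ‖t • a‖) (𝓝 0) (𝓝 0) := by
    have : Continuous fun t : ℝ => ‖t • a‖ := by fun_prop
    simpa using this.tendsto 0
  have hev : ∀ᶠ t : ℝ in 𝓝 0, ‖t • a‖ < δ / 2 := hc.eventually_lt_const (by positivity)
  have hlow : ∀ t : ℝ, ‖t • a‖ < δ / 2 → ∀ y ∈ T, δ / 2 ≤ ‖x + t • a - y‖ := fun t ht y hy => by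
    have h1 := h y hy
    have h2 : ‖x - y‖ ≤ ‖x + t • a - y‖ + ‖t • a‖ := by
      have := norm_sub_le (x + t • a - y) (t • a)
      rwa [show x + t • a - y - t • a = x - y by abel] at this
    linarith
  have hnot : ∀ t : ℝ, ‖t • a‖ < δ / 2 → x + t • a ∉ T := fun t ht hmem => by
    have := hlow t ht _ hmem
    rw [sub_self, norm_zero] at this
    linarith
  have hae : ∀ᵐ y ∂m, y ∈ T := hm
  have key := hasDerivAt_integral_of_dominated_loc_of_deriv_le (μ := m) (x₀ := (0 : ℝ))
    (F := fun t y => k (x + t • a - y) (f y)) (F' := fun t y => k' (x + t • a - y) (f y))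
    (bound := fun y => C * ‖f y‖) hev ?_ ?_ ?_ ?_ (hf.norm.const_mul C) ?_
  · simpa using key.2
  · filter_upwards [hev] with t ht
    exact (integrable_kernel hk hkm hf hT hm (hnot t ht)).1
  · simpa using integrable_kernel hk hkm hf hT hm hx
  · simpa using (integrable_kernel hk' hkm' hf hT hm hx).1
  · filter_upwards [hae] with y hy t ht
    exact hC _ _ (hlow t ht y hy)
  · filter_upwards [hae] with y hy t ht
    have h0 : x + t • a - y ≠ 0 :=
      norm_pos_iff.1 (lt_of_lt_of_le (by positivity) (hlow t ht y hy))
    refine hasDerivAt_shift (F := fun x => k (x - y) (f y)) ?_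
    refine (hd _ h0 (f y)).congr_of_eventuallyEq (Eventually.of_forall fun s => ?_)
    simp only
    congr 1
    abel

end Magnetostatics
end

noncomputable section
namespace Magnetostatics
open scoped InnerProductSpace ENNReal Topology
open Filter

/-! ### A maximum principle for functions that are harmonic along coordinate lines -/

/-- The restriction of `F` to the line through `x` in the direction `a` has second derivative `D`
at `x`. -/
def HasLineDeriv₂At (F : R3 → ℝ) (x a : R3) (D : ℝ) : Prop :=
  ∃ g : ℝ → ℝ, (∀ᶠ t in 𝓝 0, HasDerivAt (fun s : ℝ => F (x + s • a)) (g t) t) ∧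
    HasDerivAt g D 0

/-- The sum of the second derivatives along coordinate lines exists and vanishes at `x`. -/
def LineHarmonicAt (F : R3 → ℝ) (x : R3) : Prop :=
  ∃ D : Fin 3 → ℝ, ∑ l, D l = 0 ∧
    ∀ l, HasLineDeriv₂At F x (EuclideanSpace.basisFun (Fin 3) ℝ l) (D l)

theorem LineHarmonicAt.congr {F G : R3 → ℝ} {x : R3} (hF : LineHarmonicAt F x)
    (h : F =ᶠ[𝓝 x] G) : LineHarmonicAt G x := by
  obtain ⟨D, hD, hl⟩ := hF
  refine ⟨D, hD, fun l => ?_⟩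
  obtain ⟨g, hg, hg'⟩ := hl l
  refine ⟨g, ?_, hg'⟩
  have hc : Tendsto (fun s : ℝ => x + s • EuclideanSpace.basisFun (Fin 3) ℝ l) (𝓝 0) (𝓝 x) := by
    have : Continuous fun s : ℝ => x + s • EuclideanSpace.basisFun (Fin 3) ℝ l := by fun_prop
    simpa using this.tendsto 0
  filter_upwards [hg, (hc.eventually h).eventually_nhds] with t ht ht2
  exact ht.congr_of_eventuallyEq (ht2.mono fun s hs => hs.symm)

theorem LineHarmonicAt.neg {F : R3 → ℝ} {x : R3} (hF : LineHarmonicAt F x) :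
    LineHarmonicAt (fun x => -F x) x := by
  obtain ⟨D, hD, hl⟩ := hF
  refine ⟨fun l => -D l, by rw [Finset.sum_neg_distrib, hD, neg_zero], fun l => ?_⟩
  obtain ⟨g, hg, hg'⟩ := hl l
  exact ⟨fun t => -g t, hg.mono fun t ht => ht.fun_neg, hg'.fun_neg⟩

theorem LineHarmonicAt.sum {ι : Type*} {s : Finset ι} {F : ι → R3 → ℝ} {x : R3}
    (hF : ∀ i ∈ s, LineHarmonicAt (F i) x) : LineHarmonicAt (fun x => ∑ i ∈ s, F i x) x := by
  choose! D hD hl using hF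
  choose! g hg hg' using hl
  refine ⟨fun l => ∑ i ∈ s, D i l, ?_, fun l => ⟨fun t => ∑ i ∈ s, g i l t, ?_, ?_⟩⟩
  · rw [Finset.sum_comm]
    exact Finset.sum_eq_zero hD
  · filter_upwards [(Finset.eventually_all s).2 fun i hi => hg i hi l] with t ht
    exact HasDerivAt.fun_sum ht
  · exact HasDerivAt.fun_sum fun i hi => hg' i hi l

/-- If `D` were positive, the second derivative test would make 0 a local minimum as well; `h` would
be locally constant and `D` zero. -/
theorem nonpos_of_isLocalMax {h g : ℝ → ℝ} {D : ℝ} (hmax : IsLocalMax h 0)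
    (hg : ∀ᶠ t in 𝓝 0, HasDerivAt h (g t) t) (hD : HasDerivAt g D 0) : D ≤ 0 := by
  by_contra hpos
  have he : deriv h =ᶠ[𝓝 0] g := hg.mono fun t ht => ht.deriv
  have h2 : deriv (deriv h) 0 = D := (hD.congr_of_eventuallyEq he).deriv
  have hmin := isLocalMin_of_deriv_deriv_pos (by rw [h2]; exact not_le.1 hpos) hmax.deriv_eq_zero
    hg.self_of_nhds.continuousAt
  have hconst : h =ᶠ[𝓝 0] fun _ => h 0 := by
    filter_upwards [hmax, hmin] with t h1 h2
    exact le_antisymm h1 h2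
  have h0 : deriv h =ᶠ[𝓝 0] fun _ => 0 := by
    filter_upwards [hconst.eventually_nhds] with t ht
    rw [EventuallyEq.deriv_eq ht, deriv_const]
  have : deriv (deriv h) 0 = 0 := by rw [h0.deriv_eq, deriv_const]
  exact hpos (by rw [← h2, this])

/-- Adding ε‖x‖² makes the sum of the second derivatives equal to 6ε > 0, which is impossible at an
interior maximum. Only derivatives along coordinate lines enter, so no smoothness beyond continuity
is asked for. -/
theorem nonpos_of_lineHarmonic {F : R3 → ℝ} (hF : ∀ x, LineHarmonicAt F x) (hc : Continuous F)
    (h0 : Tendsto F (cocompact R3) (𝓝 0)) (x₀ : R3) : F x₀ ≤ 0 := by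
  by_contra hpos
  rw [not_le] at hpos
  set η := F x₀
  have hev : ∀ᶠ x in cocompact R3, F x < η / 2 := h0.eventually_lt_const (by positivity)
  rw [← Metric.cobounded_eq_cocompact, ← comap_norm_atTop, eventually_comap,
    eventually_atTop] at hev
  obtain ⟨R₀, hR₀⟩ := hev
  set R := max R₀ (‖x₀‖ + 1)
  have hR : ‖x₀‖ < R := lt_of_lt_of_le (lt_add_one _) (le_max_right _ _)
  have hRpos : 0 < R := (norm_nonneg _).trans_lt hR
  -- On the sphere of radius `R` the perturbation is η/4 and `F` is below η/2, while the perturbed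
  -- function is at least η at `x₀`. So the maximum lies inside the ball.
  set ε := η / (4 * R ^ 2) with hε
  have hεpos : 0 < ε := by positivity
  obtain ⟨p, hp, hmax⟩ := (isCompact_closedBall (0 : R3) R).exists_isMaxOn
    ⟨x₀, by simpa using hR.le⟩ (f := fun x => F x + ε * ‖x‖ ^ 2)
    (by fun_prop)
  have h1 : η ≤ F p + ε * ‖p‖ ^ 2 := by
    have := hmax (show x₀ ∈ Metric.closedBall 0 R by simpa using hR.le)
    simp only [Set.mem_ofPred_eq] at this
    nlinarith [sq_nonneg ‖x₀‖]
  have hpR : ‖p‖ < R := by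
    rcases lt_or_eq_of_le (show ‖p‖ ≤ R by simpa using hp) with h | h
    · exact h
    · exfalso
      have h2 := hR₀ ‖p‖ (by rw [h]; exact le_max_left _ _) p rfl
      rw [h, hε] at h1
      have : η / (4 * R ^ 2) * R ^ 2 = η / 4 := by field_simp
      linarith
  have hloc : IsLocalMax (fun x => F x + ε * ‖x‖ ^ 2) p :=
    hmax.isLocalMax (Metric.closedBall_mem_nhds_of_mem (by simpa using hpR))
  obtain ⟨D, hD, hl⟩ := hF p
  have hle : ∀ l, D l + 2 * ε ≤ 0 := by
    intro l
    set a := EuclideanSpace.basisFun (Fin 3) ℝ l with ha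
    have hna : ‖a‖ = 1 := OrthonormalBasis.norm_eq_one _ l
    obtain ⟨g, hg, hg'⟩ := hl l
    have hcont : ContinuousAt (fun s : ℝ => p + s • a) 0 := by fun_prop
    refine nonpos_of_isLocalMax (h := fun s => F (p + s • a) + ε * ‖p + s • a‖ ^ 2)
      (g := fun t => g t + ε * (2 * (⟪p, a⟫_ℝ + t))) ?_ ?_ ?_
    · have hloc' : IsLocalMax (fun x => F x + ε * ‖x‖ ^ 2) ((fun s : ℝ => p + s • a) 0) := by
        simpa using hloc
      exact IsLocalMax.comp_continuous (g := fun s : ℝ => p + s • a) hloc' hcont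
    · filter_upwards [hg] with t ht
      refine ht.add (HasDerivAt.const_mul ε ?_)
      have h3 : HasDerivAt (fun s : ℝ => p + s • a) a t := by
        simpa using ((hasDerivAt_id t).smul_const a).const_add p
      refine h3.norm_sq.congr_deriv ?_
      rw [inner_add_left, real_inner_smul_left, real_inner_self_eq_norm_sq, hna]
      ring
    · refine hg'.add ?_
      have := (((hasDerivAt_id (0 : ℝ)).const_add ⟪p, a⟫_ℝ).const_mul 2).const_mul ε
      refine this.congr_deriv ?_
      ring
  have := Finset.sum_le_sum fun l (_ : l ∈ Finset.univ) => hle l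
  rw [Finset.sum_add_distrib, hD] at this
  simp at this
  linarith

theorem eq_zero_of_lineHarmonic {F : R3 → ℝ} (hF : ∀ x, LineHarmonicAt F x) (hc : Continuous F)
    (h0 : Tendsto F (cocompact R3) (𝓝 0)) (x : R3) : F x = 0 := by
  refine le_antisymm (nonpos_of_lineHarmonic hF hc h0 x) ?_
  have := nonpos_of_lineHarmonic (fun x => (hF x).neg) hc.neg (by simpa using h0.neg) x
  linarith

/-! ### Fields of compactly supported sources -/

theorem lineHarmonicAt_field {m : Measure R3} {f : R3 → R3} (hf : Integrable f m) {T : Set R3}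
    (hT : IsClosed T) (hm : m Tᶜ = 0) {x : R3} (hx : x ∉ T) (e : R3) :
    LineHarmonicAt (fun x => ∫ y, fieldKernel e (x - y) (f y) ∂m) x := by
  set b := EuclideanSpace.basisFun (Fin 3) ℝ
  refine ⟨fun l => ∫ y, fieldKernelDeriv₂ e (b l) (x - y) (f y) ∂m, ?_, fun l =>
    ⟨fun t => ∫ y, fieldKernelDeriv e (b l) (x + t • b l - y) (f y) ∂m, ?_, ?_⟩⟩
  · rw [← integral_finsetSum _ fun l _ => integrable_kernel (kernelBdd_fieldKernelDeriv₂ e (b l))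
      (measurable_fieldKernelDeriv₂ e (b l)) hf hT hm hx]
    have hae : ∀ᵐ y ∂m, y ∈ T := hm
    refine integral_eq_zero_of_ae ?_
    filter_upwards [hae] with y hy
    have hxy : x ≠ y := fun h => hx (by rwa [h])
    exact sum_fieldKernelDeriv₂ b (sub_ne_zero.2 hxy) e (f y)
  · have hcont : ContinuousAt (fun s : ℝ => x + s • b l) 0 := by fun_prop
    have hev : ∀ᶠ t : ℝ in 𝓝 0, x + t • b l ∈ Tᶜ :=
      hcont.eventually_mem (by simpa using hT.isOpen_compl.mem_nhds hx)
    filter_upwards [hev] with t ht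
    exact hasDerivAt_shift (F := fun x => ∫ y, fieldKernel e (x - y) (f y) ∂m)
      (hasDerivAt_integral_kernel (kernelBdd_fieldKernel e)
      (measurable_fieldKernel e) (kernelBdd_fieldKernelDeriv e (b l))
      (measurable_fieldKernelDeriv e (b l))
      (fun z hz w => hasDerivAt_fieldKernel hz e (b l) w) hf hT hm ht)
  · exact hasDerivAt_integral_kernel (kernelBdd_fieldKernelDeriv e (b l))
      (measurable_fieldKernelDeriv e (b l)) (kernelBdd_fieldKernelDeriv₂ e (b l))
      (measurable_fieldKernelDeriv₂ e (b l))
      (fun z hz w => hasDerivAt_fieldKernelDeriv hz e (b l) w) hf hT hm hx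

/-- Derivatives along coordinate lines do not imply continuity, which the maximum principle also
requires. -/
theorem continuousAt_field {m : Measure R3} {f : R3 → R3} (hf : Integrable f m) {T : Set R3}
    (hT : IsClosed T) (hm : m Tᶜ = 0) {x : R3} (hx : x ∉ T) (e : R3) :
    ContinuousAt (fun x => ∫ y, fieldKernel e (x - y) (f y) ∂m) x := by
  obtain ⟨δ, hδ, h⟩ := exists_le_norm_sub_of_notMem hT hx
  obtain ⟨C, hC⟩ := kernelBdd_fieldKernel e (δ / 2) (by positivity)
  have hae : ∀ᵐ y ∂m, y ∈ T := hm
  have hev : ∀ᶠ x' in 𝓝 x, x' ∉ T ∧ ‖x' - x‖ < δ / 2 :=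
    (hT.isOpen_compl.eventually_mem hx).and
      (Filter.mem_of_superset (Metric.ball_mem_nhds x (half_pos hδ)) fun y hy => by
        simpa [dist_eq_norm] using hy)
  refine continuousAt_of_dominated (bound := fun y => C * ‖f y‖) ?_ ?_ (hf.norm.const_mul C) ?_
  · filter_upwards [hev] with x' hx'
    exact (integrable_kernel (kernelBdd_fieldKernel e) (measurable_fieldKernel e) hf hT hm hx'.1).1
  · filter_upwards [hev] with x' hx'
    filter_upwards [hae] with y hy
    refine hC _ _ ?_
    have := norm_sub_le (x' - y) (x' - x)
    rw [show x' - y - (x' - x) = x - y by abel] at this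
    linarith [h y hy]
  · filter_upwards [hae] with y hy
    have : ‖x - y‖ ≠ 0 := norm_ne_zero_iff.2 (sub_ne_zero.2 fun h => hx (h ▸ hy))
    unfold fieldKernel
    fun_prop (disch := positivity)

theorem abs_fieldKernel_le (e z w : R3) : |fieldKernel e z w| ≤ 4 * ‖e‖ * ‖w‖ / ‖z‖ ^ 3 := by
  rcases eq_or_ne z 0 with rfl | hz
  · simp [fieldKernel]
  have hn := norm_pos_iff.2 hz
  have h1 : fieldKernel e z w
      = (⟪e, w⟫_ℝ - 3 * ((⟪z, w⟫_ℝ / ‖z‖) * (⟪z, e⟫_ℝ / ‖z‖))) / ‖z‖ ^ 3 := by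
    unfold fieldKernel
    field_simp
  rw [h1, abs_div, abs_of_nonneg (a := ‖z‖ ^ 3) (by positivity)]
  gcongr
  have h2 := abs_real_inner_le_norm e w
  have h3 : |(⟪z, w⟫_ℝ / ‖z‖) * (⟪z, e⟫_ℝ / ‖z‖)| ≤ ‖w‖ * ‖e‖ := by
    rw [abs_mul]
    exact mul_le_mul (abs_inner_div_norm_le z w) (abs_inner_div_norm_le z e) (abs_nonneg _)
      (norm_nonneg _)
  calc _ ≤ |⟪e, w⟫_ℝ| + |3 * ((⟪z, w⟫_ℝ / ‖z‖) * (⟪z, e⟫_ℝ / ‖z‖))| := abs_sub _ _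
    _ ≤ ‖e‖ * ‖w‖ + 3 * (‖w‖ * ‖e‖) := by
      rw [abs_mul, abs_of_pos (by norm_num : (0 : ℝ) < 3)]
      gcongr
    _ = _ := by ring

theorem tendsto_field_cocompact {m : Measure R3} {f : R3 → R3} (hf : Integrable f m) {T : Set R3}
    (hT : IsCompact T) (hm : m Tᶜ = 0) (e : R3) :
    Tendsto (fun x => ∫ y, fieldKernel e (x - y) (f y) ∂m) (cocompact R3) (𝓝 0) := by
  have hae : ∀ᵐ y ∂m, y ∈ T := hm
  obtain ⟨r, hr⟩ := hT.isBounded.exists_norm_le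
  have hlim : Tendsto (fun x : R3 => (∫ y, 4 * ‖e‖ * ‖f y‖ ∂m) / (‖x‖ - r) ^ 3) (cocompact R3)
      (𝓝 0) := by
    refine Tendsto.const_div_atTop ?_ _
    refine (tendsto_pow_atTop (by norm_num)).comp (tendsto_atTop_add_const_right _ _ ?_)
    exact tendsto_norm_cocompact_atTop
  refine squeeze_zero_norm' ?_ hlim
  filter_upwards [tendsto_norm_cocompact_atTop.eventually_gt_atTop r] with x hx
  rw [← integral_div]
  refine norm_integral_le_of_norm_le ((hf.norm.const_mul _).div_const _) ?_
  filter_upwards [hae] with y hy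
  refine (abs_fieldKernel_le e _ _).trans ?_
  have h1 : ‖x‖ - r ≤ ‖x - y‖ := by
    have := norm_sub_norm_le x y
    linarith [hr y hy]
  have h2 : 0 < ‖x‖ - r := by linarith
  gcongr

theorem restrict_compl_self (m : Measure R3) {T : Set R3} (hT : IsClosed T) :
    (m.restrict T) Tᶜ = 0 := by
  rw [Measure.restrict_apply hT.measurableSet.compl]
  simp

theorem sum_setIntegral_eq {n : ℕ} {T : Fin n → Set R3} (hT : ∀ i, IsClosed (T i))
    (hd : ∀ i j, i ≠ j → Disjoint (T i) (T j)) {m : Measure R3} (hm : m (⋃ i, T i)ᶜ = 0)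
    {g : R3 → ℝ} (hg : Integrable g m) :
    ∑ i, ∫ y in T i, g y ∂m = ∫ y, g y ∂m := by
  rw [← integral_iUnion_fintype (fun i => (hT i).measurableSet) (fun i j hij => hd i j hij)
    fun i => hg.integrableOn, Measure.restrict_eq_self_of_ae_mem]
  exact hm

/-- The total field vanishes off the union, so near `T i` the field of the i-th piece extends across
`T i` by minus the sum of the others. The glued function is harmonic everywhere and tends to zero at
infinity. -/
theorem field_eq_zero_of_isCompact {n : ℕ} {T : Fin n → Set R3} (hT : ∀ i, IsCompact (T i))
    (hd : ∀ i j, i ≠ j → Disjoint (T i) (T j)) {m : Measure R3} (hm : m (⋃ i, T i)ᶜ = 0)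
    {f : R3 → R3} (hf : Integrable f m) (e : R3)
    (h : ∀ x ∉ ⋃ i, T i, ∫ y, fieldKernel e (x - y) (f y) ∂m = 0) (i : Fin n) {x : R3}
    (hx : x ∉ T i) : ∫ y in T i, fieldKernel e (x - y) (f y) ∂m = 0 := by
  classical
  have hc : ∀ i, IsClosed (T i) := fun i => (hT i).isClosed
  have hcU : IsClosed (⋃ i, T i) := isClosed_iUnion_of_finite hc
  set G : Fin n → R3 → ℝ := fun j x => ∫ y in T j, fieldKernel e (x - y) (f y) ∂m
  set H : R3 → ℝ := fun x => -∑ j ∈ Finset.univ.erase i, G j x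
  set F : R3 → ℝ := fun x => if x ∈ T i then H x else G i x with hF
  have hsum : ∀ x ∉ ⋃ i, T i, G i x = H x := fun x hx => by
    have h1 := h x hx
    rw [← sum_setIntegral_eq hc hd hm (integrable_kernel (kernelBdd_fieldKernel e)
      (measurable_fieldKernel e) hf hcU hm hx),
      ← Finset.add_sum_erase _ _ (Finset.mem_univ i)] at h1
    linarith
  have hlh : ∀ j x, x ∉ T j → LineHarmonicAt (G j) x := fun j x hx =>
    lineHarmonicAt_field hf.integrableOn (hc j) (restrict_compl_self m (hc j)) hx e
  have hcont : ∀ j x, x ∉ T j → ContinuousAt (G j) x := fun j x hx =>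
    continuousAt_field hf.integrableOn (hc j) (restrict_compl_self m (hc j)) hx e
  have hne : ∀ x ∈ T i, ∀ j ∈ Finset.univ.erase i, x ∉ T j := fun x hx j hj hxj =>
    Set.disjoint_left.1 (hd j i (Finset.ne_of_mem_erase hj)) hxj hx
  have hout : ∀ x ∉ T i, G i =ᶠ[𝓝 x] F := fun x hx => by
    filter_upwards [(hc i).isOpen_compl.mem_nhds hx] with y hy
    exact (if_neg hy).symm
  have hin : ∀ x ∈ T i, H =ᶠ[𝓝 x] F := fun x hx => by
    -- Near a point of `T i` the other pieces are absent, so `H` is harmonic there and agrees with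
    -- `G i` off `T i`.
    have : ∀ᶠ y in 𝓝 x, ∀ j ∈ Finset.univ.erase i, y ∉ T j :=
      (Finset.eventually_all _).2 fun j hj => (hc j).isOpen_compl.mem_nhds (hne x hx j hj)
    filter_upwards [this] with y hy
    by_cases hyi : y ∈ T i
    · exact (if_pos hyi).symm
    · rw [hF]
      simp only [if_neg hyi]
      refine (hsum y fun hmem => ?_).symm
      obtain ⟨j, hj⟩ := Set.mem_iUnion.1 hmem
      by_cases hji : j = i
      · exact hyi (hji ▸ hj)
      · exact hy j (Finset.mem_erase.2 ⟨hji, Finset.mem_univ j⟩) hj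
  have hFx : F x = G i x := if_neg hx
  change G i x = 0
  rw [← hFx]
  refine eq_zero_of_lineHarmonic (fun x => ?_) (continuous_iff_continuousAt.2 fun x => ?_) ?_ x
  · by_cases hx : x ∈ T i
    · exact (LineHarmonicAt.sum fun j hj => hlh j x (hne x hx j hj)).neg.congr (hin x hx)
    · exact (hlh i x hx).congr (hout x hx)
  · by_cases hx : x ∈ T i
    · refine ContinuousAt.congr ?_ (hin x hx)
      exact (tendsto_finsetSum _ fun j hj => hcont j x (hne x hx j hj)).neg
    · exact (hcont i x hx).congr (hout x hx)
  · refine (tendsto_field_cocompact hf.integrableOn (hT i) (restrict_compl_self m (hc i)) e).congr' ?_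
    filter_upwards [(hT i).compl_mem_cocompact] with y hy
    exact (if_neg hy).symm

/-! ### The far field of a compactly supported source -/

theorem fieldKernel_smul {c : ℝ} (hc : 0 < c) (e z w : R3) :
    c ^ 3 * fieldKernel e (c • z) w = fieldKernel e z w := by
  simp only [fieldKernel, norm_smul, real_inner_smul_left, Real.norm_of_nonneg hc.le, mul_pow]
  rcases eq_or_ne z 0 with rfl | hz
  · simp
  have := norm_ne_zero_iff.2 hz
  field_simp

/-- By homogeneity of degree -3, R³ times the field integral at R • u tends, as R → ∞, to that of a
dipole at the origin carrying the net moment, namely -2⟪u, moment⟫. -/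
theorem moment_eq_zero_of_isCompact {T : Set R3} (hT : IsCompact T) {m : Measure R3}
    (hm : m Tᶜ = 0) {f : R3 → R3} (hf : Integrable f m)
    (h : ∀ e, ∀ x ∉ T, ∫ y, fieldKernel e (x - y) (f y) ∂m = 0) : ∫ y, f y ∂m = 0 := by
  have hae : ∀ᵐ y ∂m, y ∈ T := hm
  obtain ⟨r, hr⟩ := hT.isBounded.exists_norm_le
  suffices hu : ∀ u : R3, ‖u‖ = 1 → ⟪u, ∫ y, f y ∂m⟫_ℝ = 0 by
    by_contra hne
    have := hu (‖∫ y, f y ∂m‖⁻¹ • ∫ y, f y ∂m) (norm_smul_inv_norm hne)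
    rw [real_inner_smul_left, real_inner_self_eq_norm_sq] at this
    have hn := norm_ne_zero_iff.2 hne
    exact hn (by field_simp at this; exact this)
  intro u hu
  -- For R ≥ 2r the rescaled source lies in the ball of radius 1/2, hence at distance at least 1/2
  -- from the unit vector `u`.
  obtain ⟨C, hC⟩ := kernelBdd_fieldKernel u (1 / 2) (by norm_num)
  have hlim : Tendsto (fun R : ℝ => ∫ y, fieldKernel u (u - R⁻¹ • y) (f y) ∂m) atTop
      (𝓝 (∫ y, fieldKernel u u (f y) ∂m)) := by
    refine tendsto_integral_filter_of_dominated_convergence (fun y => C * ‖f y‖) ?_ ?_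
      (hf.norm.const_mul C) ?_
    · refine Eventually.of_forall fun R => ?_
      exact ((measurable_fieldKernel u).comp_aemeasurable
        ((measurable_const.sub (measurable_id.const_smul R⁻¹)).aemeasurable.prodMk
          hf.1.aemeasurable)).aestronglyMeasurable
    · filter_upwards [eventually_ge_atTop (2 * r), eventually_gt_atTop 0] with R hR hR0
      filter_upwards [hae] with y hy
      refine hC _ _ ?_
      have h1 := norm_sub_norm_le u (R⁻¹ • y)
      have h2 : ‖R⁻¹ • y‖ ≤ 1 / 2 := by
        rw [norm_smul, norm_inv, Real.norm_of_nonneg hR0.le, inv_mul_le_iff₀ hR0]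
        linarith [hr y hy]
      linarith
    · refine Eventually.of_forall fun y => ?_
      have hc : ContinuousAt (fun s : ℝ => fieldKernel u (u - s • y) (f y)) 0 := by
        have h0 : ‖u - (0 : ℝ) • y‖ ≠ 0 := by simp [hu]
        unfold fieldKernel
        fun_prop (disch := positivity)
      have := hc.tendsto.comp tendsto_inv_atTop_zero
      simpa [Function.comp_def] using this
  have hzero : (fun R : ℝ => ∫ y, fieldKernel u (u - R⁻¹ • y) (f y) ∂m) =ᶠ[atTop] fun _ => 0 := by
    filter_upwards [eventually_gt_atTop r, eventually_gt_atTop 0] with R hR hR0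
    have h1 := h u (R • u) fun hmem => by
      have := hr _ hmem
      rw [norm_smul, hu, mul_one, Real.norm_of_nonneg hR0.le] at this
      linarith
    rw [← mul_zero (R ^ 3), ← h1, ← integral_const_mul]
    congr 1
    funext y
    rw [← fieldKernel_smul hR0, smul_sub, smul_inv_smul₀ hR0.ne']
  have h2 := tendsto_nhds_unique (hlim.congr' hzero) tendsto_const_nhds
  have h3 : ∀ w, fieldKernel u u w = -2 * ⟪u, w⟫_ℝ := fun w => by
    simp only [fieldKernel, hu, real_inner_self_eq_norm_sq]
    ring
  simp only [h3] at h2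
  rw [integral_const_mul, integral_inner hf] at h2
  linarith

end Magnetostatics
end

noncomputable section
namespace Magnetostatics
open scoped InnerProductSpace ContDiff Topology
open Filter

/-! ### The Newtonian kernel -/

theorem fderiv_eq_of_hasDerivAt_line {g : R3 → ℝ} {x v : R3} {d : ℝ}
    (hg : DifferentiableAt ℝ g x) (h : HasDerivAt (fun t : ℝ => g (x + t • v)) d 0) :
    fderiv ℝ g x v = d := by
  rw [← hg.lineDeriv_eq_fderiv]
  exact h.deriv

theorem integral_fderiv_mul_eq_neg {φ g : R3 → ℝ} (hφ : ContDiff ℝ 1 φ) (hs : HasCompactSupport φ)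
    (hg : ContDiff ℝ 1 g) (v : R3) :
    ∫ x, fderiv ℝ φ x v * g x = -∫ x, φ x * fderiv ℝ g x v := by
  have hφ' : Continuous fun x => fderiv ℝ φ x v :=
    (hφ.continuous_fderiv one_ne_zero).clm_apply continuous_const
  have hg' : Continuous fun x => fderiv ℝ g x v :=
    (hg.continuous_fderiv one_ne_zero).clm_apply continuous_const
  have hs' : HasCompactSupport fun x => fderiv ℝ φ x v := hs.fderiv_apply ℝ v
  rw [integral_mul_fderiv_eq_neg_fderiv_mul_of_integrable
    ((hφ'.mul hg.continuous).integrable_of_hasCompactSupport hs'.mul_right)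
    ((hφ.continuous.mul hg').integrable_of_hasCompactSupport hs.mul_right)
    ((hφ.continuous.mul hg.continuous).integrable_of_hasCompactSupport hs.mul_right)
    (fun x _ => hφ.differentiable one_ne_zero x) (fun x _ => hg.differentiable one_ne_zero x),
    neg_neg]

/-- The directional derivative of `φ` in the direction `v`. -/
def dirDeriv (v : R3) (φ : R3 → ℝ) (x : R3) : ℝ := fderiv ℝ φ x v

theorem contDiff_dirDeriv {φ : R3 → ℝ} (hφ : ContDiff ℝ ∞ φ) (v : R3) :
    ContDiff ℝ ∞ (dirDeriv v φ) :=
  (hφ.fderiv_right (m := ∞) (by norm_cast)).clm_apply contDiff_const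

theorem hasCompactSupport_dirDeriv {φ : R3 → ℝ} (hφ : HasCompactSupport φ) (v : R3) :
    HasCompactSupport (dirDeriv v φ) := hφ.fderiv_apply ℝ v

theorem dirDeriv_comm {φ : R3 → ℝ} (hφ : ContDiff ℝ ∞ φ) (v w : R3) :
    dirDeriv v (dirDeriv w φ) = dirDeriv w (dirDeriv v φ) := by
  funext x
  have hd : DifferentiableAt ℝ (fderiv ℝ φ) x :=
    (hφ.fderiv_right (m := ∞) (by norm_cast)).differentiable (by simp) x
  have h : ∀ v w, dirDeriv v (dirDeriv w φ) x = fderiv ℝ (fderiv ℝ φ) x v w := fun v w => by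
    unfold dirDeriv
    rw [fderiv_clm_apply hd (differentiableAt_const w)]
    simp
  rw [h, h]
  exact (hφ.contDiffAt.isSymmSndFDerivAt (by simp; norm_cast)).eq v w

/-- The Laplacian of `φ` as the sum of pure second derivatives. -/
def lap (φ : R3 → ℝ) (x : R3) : ℝ :=
  ∑ l, dirDeriv (EuclideanSpace.basisFun (Fin 3) ℝ l)
    (dirDeriv (EuclideanSpace.basisFun (Fin 3) ℝ l) φ) x

theorem contDiff_lap {φ : R3 → ℝ} (hφ : ContDiff ℝ ∞ φ) : ContDiff ℝ ∞ (lap φ) :=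
  ContDiff.sum fun _ _ => contDiff_dirDeriv (contDiff_dirDeriv hφ _) _

theorem hasCompactSupport_lap {φ : R3 → ℝ} (hs : HasCompactSupport φ) :
    HasCompactSupport (lap φ) := by
  refine HasCompactSupport.intro hs fun x hx => Finset.sum_eq_zero fun l _ => ?_
  refine image_eq_zero_of_notMem_tsupport fun h => hx ?_
  exact tsupport_fderiv_apply_subset ℝ _ (tsupport_fderiv_apply_subset ℝ _ h)

theorem dirDeriv_lap {φ : R3 → ℝ} (hφ : ContDiff ℝ ∞ φ) (w : R3) :
    dirDeriv w (lap φ) = lap (dirDeriv w φ) := by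
  funext x
  have h : dirDeriv w (lap φ) x = ∑ l, dirDeriv w (dirDeriv (EuclideanSpace.basisFun (Fin 3) ℝ l)
      (dirDeriv (EuclideanSpace.basisFun (Fin 3) ℝ l) φ)) x := by
    unfold dirDeriv lap
    rw [fderiv_fun_sum fun l _ => (contDiff_dirDeriv (contDiff_dirDeriv hφ _) _).differentiable
      (by simp) x]
    simp
    rfl
  rw [h, lap]
  refine Finset.sum_congr rfl fun l _ => ?_
  rw [dirDeriv_comm (contDiff_dirDeriv hφ _), dirDeriv_comm hφ]

/-- The regularized distance `√(‖z‖² + ε²)`. -/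
def regNorm (ε : ℝ) (z : R3) : ℝ := √(‖z‖ ^ 2 + ε ^ 2)

theorem regNorm_pos {ε : ℝ} (hε : 0 < ε) (z : R3) : 0 < regNorm ε z :=
  Real.sqrt_pos.2 (by positivity)

theorem regNorm_sq (ε : ℝ) (z : R3) : regNorm ε z ^ 2 = ‖z‖ ^ 2 + ε ^ 2 :=
  Real.sq_sqrt (by positivity)

theorem norm_le_regNorm (ε : ℝ) (z : R3) : ‖z‖ ≤ regNorm ε z :=
  Real.le_sqrt_of_sq_le (by nlinarith [sq_nonneg ε])

theorem contDiff_regNorm {ε : ℝ} (hε : 0 < ε) : ContDiff ℝ ∞ (regNorm ε) :=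
  ((contDiff_norm_sq ℝ).add contDiff_const).sqrt fun z => by positivity

theorem hasDerivAt_line_regNorm {ε : ℝ} (hε : 0 < ε) (z a : R3) :
    HasDerivAt (fun t : ℝ => regNorm ε (z + t • a)) (⟪z, a⟫_ℝ / regNorm ε z) 0 := by
  have h := ((hasDerivAt_line z a).norm_sq.add_const (ε ^ 2)).sqrt (by positivity)
  refine h.congr_deriv ?_
  simp only [zero_smul, add_zero]
  change _ / (2 * regNorm ε z) = _
  have := (regNorm_pos hε z).ne'
  field_simp

theorem dirDeriv_regInv {ε : ℝ} (hε : 0 < ε) (y v : R3) :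
    dirDeriv v (fun x => (regNorm ε (x - y))⁻¹)
      = fun x => -(⟪x - y, v⟫_ℝ / regNorm ε (x - y) ^ 3) := by
  funext x
  have hp := (regNorm_pos hε (x - y)).ne'
  have hd := ((contDiff_regNorm hε).comp (contDiff_id.sub (contDiff_const (c := y)))).inv
    fun x => (regNorm_pos hε (x - y)).ne'
  refine fderiv_eq_of_hasDerivAt_line (hd.differentiable (by simp) x) ?_
  have h := (hasDerivAt_line_regNorm hε (x - y) v).inv (by simpa using hp)
  refine (h.congr_of_eventuallyEq (Eventually.of_forall fun t => ?_)).congr_deriv ?_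
  · simp only [Pi.inv_apply]
    congr 2
    abel
  · simp only [zero_smul, add_zero]
    field_simp

theorem contDiff_regInv {ε : ℝ} (hε : 0 < ε) (y : R3) :
    ContDiff ℝ ∞ fun x => (regNorm ε (x - y))⁻¹ :=
  ((contDiff_regNorm hε).comp (contDiff_id.sub (contDiff_const (c := y)))).inv
    fun x => (regNorm_pos hε (x - y)).ne'

theorem dirDeriv_dirDeriv_regInv {ε : ℝ} (hε : 0 < ε) (y v : R3) :
    dirDeriv v (dirDeriv v fun x => (regNorm ε (x - y))⁻¹)
      = fun x => -(⟪v, v⟫_ℝ / regNorm ε (x - y) ^ 3)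
        + 3 * (⟪x - y, v⟫_ℝ ^ 2 / regNorm ε (x - y) ^ 5) := by
  funext x
  have hp := (regNorm_pos hε (x - y)).ne'
  refine fderiv_eq_of_hasDerivAt_line
    ((contDiff_dirDeriv (contDiff_regInv hε y) v).differentiable (by simp) x) ?_
  rw [dirDeriv_regInv hε]
  have h := ((hasDerivAt_line_inner (x - y) v v).div
    ((hasDerivAt_line_regNorm hε (x - y) v).pow 3) (pow_ne_zero 3 (by simpa using hp))).neg
  refine (h.congr_of_eventuallyEq (Eventually.of_forall fun t => ?_)).congr_deriv ?_
  · simp only [Pi.neg_apply, Pi.div_apply, Pi.pow_apply]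
    rw [show x + t • v - y = x - y + t • v by abel]
  · simp only [zero_smul, add_zero, Pi.pow_apply, Nat.cast_ofNat]
    field_simp
    ring

/-- The right side is, up to sign, an approximate identity concentrating at `y` as ε → 0: a smooth
substitute for the Laplacian of 1/‖x - y‖ being a multiple of the Dirac mass. -/
theorem lap_regInv {ε : ℝ} (hε : 0 < ε) (y : R3) :
    lap (fun x => (regNorm ε (x - y))⁻¹)
      = fun x => -(3 * ε ^ 2 / regNorm ε (x - y) ^ 5) := by
  funext x
  have hp := (regNorm_pos hε (x - y)).ne'
  have hs := (EuclideanSpace.basisFun (Fin 3) ℝ).sum_inner_mul_inner (x - y) (x - y)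
  rw [Fin.sum_univ_three, real_inner_self_eq_norm_sq] at hs
  have n : ∀ l, ⟪EuclideanSpace.basisFun (Fin 3) ℝ l, EuclideanSpace.basisFun (Fin 3) ℝ l⟫_ℝ = 1 :=
    fun l => by rw [real_inner_self_eq_norm_sq, OrthonormalBasis.norm_eq_one]; norm_num
  unfold lap
  simp only [dirDeriv_dirDeriv_regInv hε, Fin.sum_univ_three, n]
  simp only [real_inner_comm (x - y) (EuclideanSpace.basisFun (Fin 3) ℝ _)] at hs
  have hq := regNorm_sq ε (x - y)
  rw [← hs] at hq
  generalize ⟪x - y, EuclideanSpace.basisFun (Fin 3) ℝ 0⟫_ℝ = a at *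
  generalize ⟪x - y, EuclideanSpace.basisFun (Fin 3) ℝ 1⟫_ℝ = b at *
  generalize ⟪x - y, EuclideanSpace.basisFun (Fin 3) ℝ 2⟫_ℝ = c at *
  generalize regNorm ε (x - y) = s at *
  field_simp
  linear_combination (-3) * hq

theorem integral_lap_mul_eq {φ g : R3 → ℝ} (hφ : ContDiff ℝ ∞ φ) (hs : HasCompactSupport φ)
    (hg : ContDiff ℝ ∞ g) : ∫ x, lap φ x * g x = ∫ x, φ x * lap g x := by
  unfold lap
  have c1 : ∀ {h : R3 → ℝ}, ContDiff ℝ ∞ h → ContDiff ℝ 1 h := fun h => h.of_le (by norm_cast)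
  have hD := fun v => contDiff_dirDeriv hφ v
  have hDs := fun v => hasCompactSupport_dirDeriv hs v
  simp only [Finset.sum_mul, Finset.mul_sum]
  rw [integral_finsetSum, integral_finsetSum]
  · refine Finset.sum_congr rfl fun l _ => ?_
    have h1 := integral_fderiv_mul_eq_neg (c1 (hD (EuclideanSpace.basisFun (Fin 3) ℝ l))) (hDs _)
      (c1 hg) (EuclideanSpace.basisFun (Fin 3) ℝ l)
    have h2 := integral_fderiv_mul_eq_neg (c1 hφ) hs (c1 (contDiff_dirDeriv hg
      (EuclideanSpace.basisFun (Fin 3) ℝ l))) (EuclideanSpace.basisFun (Fin 3) ℝ l)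
    unfold dirDeriv at *
    rw [h1, h2, neg_neg]
  · intro l _
    exact (hφ.continuous.mul (contDiff_dirDeriv (contDiff_dirDeriv hg _)
      _).continuous).integrable_of_hasCompactSupport hs.mul_right
  · intro l _
    exact ((contDiff_dirDeriv (hD _) _).continuous.mul
      hg.continuous).integrable_of_hasCompactSupport (hasCompactSupport_dirDeriv (hDs _) _).mul_right

/-- The regularized dipole kernel is minus the derivative along `w` of the regularized 1/‖x - y‖.
Both this derivative and the Laplacian are moved by parts. -/
theorem integral_lap_mul_regKernel {ε : ℝ} (hε : 0 < ε) {φ : R3 → ℝ} (hφ : ContDiff ℝ ∞ φ)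
    (hs : HasCompactSupport φ) (y w : R3) :
    ∫ x, lap φ x * (⟪x - y, w⟫_ℝ / regNorm ε (x - y) ^ 3)
      = -∫ x, dirDeriv w φ x * (3 * ε ^ 2 / regNorm ε (x - y) ^ 5) := by
  have c1 : ∀ {h : R3 → ℝ}, ContDiff ℝ ∞ h → ContDiff ℝ 1 h := fun h => h.of_le (by norm_cast)
  have h1 := integral_fderiv_mul_eq_neg (c1 (contDiff_lap hφ)) (hasCompactSupport_lap hs)
    (c1 (contDiff_regInv hε y)) w
  have h2 := integral_lap_mul_eq (contDiff_dirDeriv hφ w) (hasCompactSupport_dirDeriv hs w)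
    (contDiff_regInv hε y)
  rw [← dirDeriv_lap hφ, lap_regInv hε] at h2
  change ∫ x, dirDeriv w (lap φ) x * _ = -∫ x, lap φ x * dirDeriv w _ x at h1
  rw [h2, dirDeriv_regInv hε] at h1
  simp only [mul_neg, integral_neg, neg_neg] at h1
  exact h1.symm

theorem integral_mul_regKernel_eq {ε : ℝ} (hε : 0 < ε) (ψ : R3 → ℝ) (y : R3) :
    ∫ x, ψ x * (3 * ε ^ 2 / regNorm ε (x - y) ^ 5)
      -- Substituting x = y + ε • z, the Jacobian ε³ and the factor ε² cancel the ε⁵ from the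
      -- denominator.
      = ∫ z, ψ (y + ε • z) * (3 / regNorm 1 z ^ 5) := by
  rw [← integral_add_left_eq_self (fun x => ψ x * (3 * ε ^ 2 / regNorm ε (x - y) ^ 5)) y]
  have h := Measure.integral_comp_smul_of_nonneg volume
    (fun x => ψ (y + x) * (3 * ε ^ 2 / regNorm ε (y + x - y) ^ 5)) ε (hR := hε.le)
  have hfin : Module.finrank ℝ R3 = 3 := by simp
  rw [hfin, smul_eq_mul, eq_comm, inv_mul_eq_iff_eq_mul₀ (by positivity)] at h
  rw [h, ← integral_const_mul]
  congr 1
  funext z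
  have hr : regNorm ε (ε • z) = ε * regNorm 1 z := by
    unfold regNorm
    rw [norm_smul, Real.norm_of_nonneg hε.le,
      show (ε * ‖z‖) ^ 2 + ε ^ 2 = ε ^ 2 * (‖z‖ ^ 2 + 1 ^ 2) by ring,
      Real.sqrt_mul (by positivity), Real.sqrt_sq hε.le]
  rw [add_sub_cancel_left, hr]
  have := (regNorm_pos one_pos z).ne'
  field_simp

theorem integrable_regKernel : Integrable fun z : R3 => 3 / regNorm 1 z ^ 5 := by
  have h := (integrable_rpow_neg_one_add_norm_sq (E := R3) (μ := volume) (r := 5)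
    (by simp; norm_num)).const_mul 3
  refine h.congr (Eventually.of_forall fun z => ?_)
  simp only [regNorm]
  rw [Real.sqrt_eq_rpow, ← Real.rpow_mul_natCast (by positivity), neg_div,
    Real.rpow_neg (by positivity), ← div_eq_mul_inv]
  congr 2
  · ring
  · norm_num

/-- The normalizing constant of the Newtonian kernel. -/
def newtonConstant : ℝ := ∫ z : R3, 3 / regNorm 1 z ^ 5

/-- Only nonvanishing matters; the value of the constant plays no role. -/
theorem newtonConstant_pos : 0 < newtonConstant := by
  have hp : ∀ z : R3, 0 < 3 / regNorm 1 z ^ 5 := fun z =>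
    div_pos (by norm_num) (pow_pos (regNorm_pos one_pos z) 5)
  refine (integral_pos_iff_support_of_nonneg (fun z => (hp z).le) integrable_regKernel).2 ?_
  rw [Function.support_eq_univ fun z => (hp z).ne']
  simp

theorem tendsto_integral_mul_regKernel {ψ : R3 → ℝ} (hψ : Continuous ψ) (hs : HasCompactSupport ψ)
    (y : R3) :
    Tendsto (fun ε : ℝ => ∫ x, ψ x * (3 * ε ^ 2 / regNorm ε (x - y) ^ 5)) (𝓝[>] 0)
      (𝓝 (ψ y * newtonConstant)) := by
  obtain ⟨M, hM⟩ := hψ.bounded_above_of_compact_support hs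
  have h : Tendsto (fun ε : ℝ => ∫ z, ψ (y + ε • z) * (3 / regNorm 1 z ^ 5)) (𝓝[>] 0)
      (𝓝 (∫ z, ψ y * (3 / regNorm 1 z ^ 5))) := by
    refine tendsto_integral_filter_of_dominated_convergence
      (fun z => M * (3 / regNorm 1 z ^ 5)) ?_ ?_ (integrable_regKernel.const_mul M) ?_
    · refine Eventually.of_forall fun ε => ?_
      have : Continuous fun z : R3 => ψ (y + ε • z) := by fun_prop
      exact this.aestronglyMeasurable.mul integrable_regKernel.1
    · refine Eventually.of_forall fun ε => Eventually.of_forall fun z => ?_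
      rw [norm_mul, Real.norm_of_nonneg (r := 3 / regNorm 1 z ^ 5)
        (div_pos (by norm_num) (pow_pos (regNorm_pos one_pos z) 5)).le]
      exact mul_le_mul_of_nonneg_right (hM _)
        (div_pos (by norm_num) (pow_pos (regNorm_pos one_pos z) 5)).le
    · refine Eventually.of_forall fun z => Tendsto.mul_const _ ?_
      have : Continuous fun ε : ℝ => ψ (y + ε • z) := by fun_prop
      simpa using (this.tendsto 0).mono_left nhdsWithin_le_nhds
  rw [integral_const_mul] at h
  refine h.congr' ?_
  filter_upwards [self_mem_nhdsWithin] with ε hε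
  exact (integral_mul_regKernel_eq hε ψ y).symm

/-! ### Local integrability of the inverse square -/

theorem integrableOn_inv_sq_ball (r : ℝ) :
    IntegrableOn (fun z : R3 => 1 / ‖z‖ ^ 2) (Metric.ball 0 r) := by
  refine (integrableOn_fun_norm_addHaar volume (f := fun t : ℝ => 1 / t ^ 2)).2 ?_
  have hfin : Module.finrank ℝ R3 = 3 := by simp
  rw [hfin]
  refine (integrableOn_const (C := (1 : ℝ)) (by simp)).congr_fun (fun t ht => ?_) measurableSet_Ioo
  have := ht.1.ne'
  simp only [smul_eq_mul]
  field_simp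

/-- Split at distance `r` from `y`: the near part is translation invariant and finite, the far
integrand is at most r⁻². Keeping `r` free makes the coefficient of the volume as small as desired.
-/
theorem lintegral_inv_sq_le {r : ℝ} (hr : 0 < r) :
    ∃ J : ENNReal, J ≠ ⊤ ∧ ∀ (y : R3) (V : Set R3),
      ∫⁻ x in V, ENNReal.ofReal (1 / ‖x - y‖ ^ 2)
        ≤ J + ENNReal.ofReal (1 / r ^ 2) * volume V := by
  set g : R3 → ENNReal := fun z => ENNReal.ofReal (1 / ‖z‖ ^ 2)
  refine ⟨∫⁻ z in Metric.ball 0 r, g z, ?_, fun y V => ?_⟩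
  · exact ((hasFiniteIntegral_iff_ofReal (Eventually.of_forall fun z => by positivity)).1
      (integrableOn_inv_sq_ball r).2).ne
  · have hmeas : Measurable fun x : R3 => (Metric.ball 0 r).indicator g (x - y) := by
      have : Measurable ((Metric.ball (0 : R3) r).indicator g) :=
        Measurable.indicator (by fun_prop) measurableSet_ball
      exact this.comp (measurable_id.sub_const y)
    calc ∫⁻ x in V, ENNReal.ofReal (1 / ‖x - y‖ ^ 2)
        ≤ ∫⁻ x in V, ((Metric.ball 0 r).indicator g (x - y) + ENNReal.ofReal (1 / r ^ 2)) := by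
          refine lintegral_mono fun x => ?_
          by_cases hx : x - y ∈ Metric.ball 0 r
          · rw [Set.indicator_of_mem hx]
            exact le_self_add
          · rw [Set.indicator_of_notMem hx, zero_add]
            rw [mem_ball_zero_iff, not_lt] at hx
            gcongr
      _ = (∫⁻ x in V, (Metric.ball 0 r).indicator g (x - y))
          + ENNReal.ofReal (1 / r ^ 2) * volume V := by
        rw [lintegral_add_left hmeas, lintegral_const, Measure.restrict_apply_univ]
      _ ≤ (∫⁻ x, (Metric.ball 0 r).indicator g (x - y))
          + ENNReal.ofReal (1 / r ^ 2) * volume V := by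
        gcongr
        exact Measure.restrict_le_self
      _ = _ := by
        rw [lintegral_sub_right_eq_self (fun x => (Metric.ball 0 r).indicator g x) y,
          lintegral_indicator measurableSet_ball]

theorem lintegral_mul_inv_sq_le {ψ : R3 → ℝ} (hψ : Continuous ψ) (hs : HasCompactSupport ψ) :
    ∃ C : ENNReal, C ≠ ⊤ ∧ ∀ y : R3, ∫⁻ x, ENNReal.ofReal (|ψ x| * (1 / ‖x - y‖ ^ 2)) ≤ C := by
  obtain ⟨M, hM⟩ := hψ.bounded_above_of_compact_support hs
  obtain ⟨J, hJ, hle⟩ := lintegral_inv_sq_le one_pos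
  refine ⟨ENNReal.ofReal M * (J + ENNReal.ofReal (1 / 1 ^ 2) * volume (tsupport ψ)), ?_, fun y => ?_⟩
  · have := hs.measure_ne_top (μ := volume)
    finiteness
  · have hsub : (Function.support fun x => ENNReal.ofReal (|ψ x| * (1 / ‖x - y‖ ^ 2)))
        ⊆ tsupport ψ := fun x hx => by
      by_contra h
      exact hx (by simp [image_eq_zero_of_notMem_tsupport h])
    rw [← setLIntegral_eq_of_support_subset hsub]
    calc _ ≤ ∫⁻ x in tsupport ψ, ENNReal.ofReal M * ENNReal.ofReal (1 / ‖x - y‖ ^ 2) := by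
          refine lintegral_mono fun x => ?_
          rw [← ENNReal.ofReal_mul' (by positivity)]
          exact ENNReal.ofReal_le_ofReal (mul_le_mul_of_nonneg_right (hM x) (by positivity))
      _ = ENNReal.ofReal M * ∫⁻ x in tsupport ψ, ENNReal.ofReal (1 / ‖x - y‖ ^ 2) :=
        lintegral_const_mul _ (by fun_prop)
      _ ≤ _ := by
        gcongr
        exact hle y _

theorem integrable_mul_inv_sq {ψ : R3 → ℝ} (hψ : Continuous ψ) (hs : HasCompactSupport ψ)
    (y : R3) : Integrable fun x => |ψ x| * (1 / ‖x - y‖ ^ 2) := by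
  obtain ⟨C, hC, h⟩ := lintegral_mul_inv_sq_le hψ hs
  have hm := hψ.measurable
  refine ⟨Measurable.aestronglyMeasurable (by fun_prop), ?_⟩
  exact (hasFiniteIntegral_iff_ofReal (Eventually.of_forall fun x => by positivity)).2
    ((h y).trans_lt hC.lt_top)

theorem abs_inner_div_pow_le {z w : R3} {s : ℝ} (hs : ‖z‖ ≤ s) :
    |⟪z, w⟫_ℝ / s ^ 3| ≤ ‖w‖ * (1 / ‖z‖ ^ 2) := by
  rcases eq_or_ne z 0 with rfl | hz
  · simp
  have hn := norm_pos_iff.2 hz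
  rw [abs_div, abs_of_nonneg (a := s ^ 3) (pow_nonneg (hn.le.trans hs) 3)]
  calc |⟪z, w⟫_ℝ| / s ^ 3 ≤ ‖z‖ * ‖w‖ / ‖z‖ ^ 3 := by
        gcongr
        exact abs_real_inner_le_norm z w
    _ = _ := by field_simp

/-- Limit ε → 0 of the regularized identity, dominated by a multiple of |lap φ x| / ‖x - y‖², which
is integrable in dimension three. -/
theorem integral_lap_mul_potentialKernel {φ : R3 → ℝ} (hφ : ContDiff ℝ ∞ φ)
    (hs : HasCompactSupport φ) (y w : R3) :
    ∫ x, lap φ x * potentialKernel (x - y) w = -(dirDeriv w φ y * newtonConstant) := by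
  have hl := (contDiff_lap hφ).continuous
  have hlm := hl.measurable
  have h1 : Tendsto (fun ε : ℝ => ∫ x, lap φ x * (⟪x - y, w⟫_ℝ / regNorm ε (x - y) ^ 3)) (𝓝[>] 0)
      (𝓝 (∫ x, lap φ x * potentialKernel (x - y) w)) := by
    refine tendsto_integral_filter_of_dominated_convergence
      (fun x => ‖w‖ * (|lap φ x| * (1 / ‖x - y‖ ^ 2))) ?_ ?_
      ((integrable_mul_inv_sq hl (hasCompactSupport_lap hs) y).const_mul _) ?_
    · refine Eventually.of_forall fun ε => Measurable.aestronglyMeasurable ?_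
      unfold regNorm
      fun_prop
    · refine Eventually.of_forall fun ε => Eventually.of_forall fun x => ?_
      rw [norm_mul, Real.norm_eq_abs, Real.norm_eq_abs, mul_left_comm]
      exact mul_le_mul_of_nonneg_left (abs_inner_div_pow_le (norm_le_regNorm ε _)) (abs_nonneg _)
    · refine Eventually.of_forall fun x => Tendsto.const_mul _ ?_
      rcases eq_or_ne (x - y) 0 with hz | hz
      · simp [hz, potentialKernel]
      · have hn := norm_pos_iff.2 hz
        have hc : ContinuousAt (fun ε : ℝ => ⟪x - y, w⟫_ℝ / regNorm ε (x - y) ^ 3) 0 := by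
          have h0 : regNorm 0 (x - y) ^ 3 ≠ 0 := by
            simp [regNorm, hn.le, hn.ne']
          refine ContinuousAt.div continuousAt_const ?_ h0
          unfold regNorm
          fun_prop
        have h2 := hc.tendsto.mono_left (nhdsWithin_le_nhds (s := Set.Ioi 0))
        have h3 : regNorm 0 (x - y) = ‖x - y‖ := by simp [regNorm, hn.le]
        rwa [h3] at h2
  have h2 := (tendsto_integral_mul_regKernel (contDiff_dirDeriv hφ w).continuous
    (hasCompactSupport_dirDeriv hs w) y).neg
  refine tendsto_nhds_unique h1 (h2.congr' ?_)
  filter_upwards [self_mem_nhdsWithin] with ε hε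
  exact (integral_lap_mul_regKernel hε hφ hs y w).symm

end Magnetostatics
end

noncomputable section
namespace Magnetostatics
open scoped InnerProductSpace ContDiff Topology
open Filter

/-! ### The potential of a silent source on a slender set -/

theorem abs_potentialKernel_le (z w : R3) : |potentialKernel z w| ≤ ‖w‖ * (1 / ‖z‖ ^ 2) :=
  abs_inner_div_pow_le le_rfl

theorem eq_on_preconnected_of_locally_eq {F : R3 → ℝ} {U : Set R3}
    (h : ∀ x ∈ U, ∀ᶠ y in 𝓝 x, y ∈ U ∧ F y = F x) {A : Set R3} (hA : IsPreconnected A)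
    (hAU : A ⊆ U) {x y : R3} (hx : x ∈ A) (hy : y ∈ A) : F y = F x := by
  have h1 : IsOpen {z | z ∈ U ∧ F z = F x} := isOpen_iff_mem_nhds.2 fun z hz => by
    filter_upwards [h z hz.1] with w hw
    exact ⟨hw.1, hw.2.trans hz.2⟩
  have h2 : IsOpen {z | z ∈ U ∧ F z ≠ F x} := isOpen_iff_mem_nhds.2 fun z hz => by
    filter_upwards [h z hz.1] with w hw
    exact ⟨hw.1, hw.2 ▸ hz.2⟩
  refine (hA.subset_left_of_subset_union h1 h2 ?_ ?_ ⟨x, hx, hAU hx, rfl⟩ hy).2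
  · exact Set.disjoint_left.2 fun z hz hz' => hz'.2 hz.2
  · exact fun z hz => (em (F z = F x)).imp (fun he => ⟨hAU hz, he⟩) fun he => ⟨hAU hz, he⟩

/-- On a segment inside a ball avoiding `S`, the derivative of the potential is a field integral,
hence zero. -/
theorem potential_locally_eq {m : Measure R3} {f : R3 → R3} (hf : Integrable f m) {S : Set R3}
    (hS : IsClosed S) (hm : m Sᶜ = 0)
    (h : ∀ e, ∀ x ∉ S, ∫ y, fieldKernel e (x - y) (f y) ∂m = 0) {x : R3} (hx : x ∈ Sᶜ) :
    ∀ᶠ x' in 𝓝 x, x' ∈ Sᶜ ∧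
      ∫ y, potentialKernel (x' - y) (f y) ∂m = ∫ y, potentialKernel (x - y) (f y) ∂m := by
  obtain ⟨δ, hδ, hsub⟩ := Metric.isOpen_iff.1 hS.isOpen_compl x hx
  filter_upwards [Metric.ball_mem_nhds x hδ] with x' hx'
  refine ⟨hsub hx', ?_⟩
  have hd : ∀ t ∈ Set.Icc (0 : ℝ) 1, HasDerivAt
      (fun t : ℝ => ∫ y, potentialKernel (x + t • (x' - x) - y) (f y) ∂m) 0 t := by
    intro t ht
    have hmem : x + t • (x' - x) ∈ Sᶜ := by
      refine hsub ?_
      rw [mem_ball_iff_norm] at hx' ⊢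
      rw [add_sub_cancel_left, norm_smul, Real.norm_of_nonneg ht.1]
      exact (mul_le_of_le_one_left (norm_nonneg _) ht.2).trans_lt hx'
    have := hasDerivAt_integral_kernel kernelBdd_potentialKernel measurable_potentialKernel
      (kernelBdd_fieldKernel (x' - x)) (measurable_fieldKernel (x' - x))
      (fun z hz w => hasDerivAt_potentialKernel hz (x' - x) w) hf hS hm hmem
    rw [h _ _ hmem] at this
    exact hasDerivAt_shift (F := fun x => ∫ y, potentialKernel (x - y) (f y) ∂m) this
  have := constant_of_has_deriv_right_zero (fun t ht => (hd t ht).continuousAt.continuousWithinAt)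
    (fun t ht => (hd t ⟨ht.1, ht.2.le⟩).hasDerivWithinAt) 1 ⟨zero_le_one, le_rfl⟩
  simpa using this

theorem lintegral_potential_le {m : Measure R3} [SFinite m] {f : R3 → R3} (hf : Integrable f m)
    {r : ℝ} (hr : 0 < r) : ∃ J : ENNReal, J ≠ ⊤ ∧ ∀ V : Set R3,
      ∫⁻ x in V, ‖∫ y, potentialKernel (x - y) (f y) ∂m‖ₑ
        ≤ (∫⁻ y, ‖f y‖ₑ ∂m) * (J + ENNReal.ofReal (1 / r ^ 2) * volume V) := by
  obtain ⟨J, hJ, hle⟩ := lintegral_inv_sq_le hr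
  refine ⟨J, hJ, fun V => ?_⟩
  calc ∫⁻ x in V, ‖∫ y, potentialKernel (x - y) (f y) ∂m‖ₑ
      ≤ ∫⁻ x in V, ∫⁻ y, ‖f y‖ₑ * ENNReal.ofReal (1 / ‖x - y‖ ^ 2) ∂m := by
        refine lintegral_mono fun x => (enorm_integral_le_lintegral_enorm _).trans
          (lintegral_mono fun y => ?_)
        rw [← ofReal_norm, ← ofReal_norm, ← ENNReal.ofReal_mul (norm_nonneg _)]
        exact ENNReal.ofReal_le_ofReal (abs_potentialKernel_le _ _)
    _ = ∫⁻ y, (∫⁻ x in V, ‖f y‖ₑ * ENNReal.ofReal (1 / ‖x - y‖ ^ 2)) ∂m := by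
        refine lintegral_lintegral_swap (AEMeasurable.mul (f := fun p : R3 × R3 => ‖f p.2‖ₑ)
          (g := fun p : R3 × R3 => ENNReal.ofReal (1 / ‖p.1 - p.2‖ ^ 2)) ?_ ?_)
        · exact hf.1.enorm.comp_snd
        · exact Measurable.aemeasurable (by fun_prop)
    _ ≤ ∫⁻ y, ‖f y‖ₑ * (J + ENNReal.ofReal (1 / r ^ 2) * volume V) ∂m := by
        refine lintegral_mono fun y => ?_
        rw [lintegral_const_mul _ (by fun_prop)]
        gcongr
        exact hle y V
    _ = _ := lintegral_mul_const'' _ hf.1.enorm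

/-- Integrating over V ⊆ U gives |c| vol V ≤ a (J + vol V / r²). With r large the last term is
absorbed in the left side, which bounds vol V, although U contains sets of arbitrarily large finite
volume. -/
theorem potential_eq_zero_of_const {m : Measure R3} [SFinite m] {f : R3 → R3}
    (hf : Integrable f m) {U : Set R3} (hUm : MeasurableSet U)
    (hU : volume U = ⊤) {c : ℝ}
    (h : ∀ x ∈ U, ∫ y, potentialKernel (x - y) (f y) ∂m = c) : c = 0 := by
  by_contra hc
  have hc' : 0 < |c| := abs_pos.2 hc
  set A := ∫⁻ y, ‖f y‖ₑ ∂m with hA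
  have hAt : A ≠ ⊤ := hf.2.ne
  set a := A.toReal with ha
  have ha0 : 0 ≤ a := ENNReal.toReal_nonneg
  obtain ⟨r, hr, hra⟩ : ∃ r : ℝ, 0 < r ∧ a * (1 / r ^ 2) ≤ |c| / 2 := by
    -- The choice r² = 2a/|c| would suffice for the estimate; adding 1 keeps `r` positive when a =
    -- 0.
    refine ⟨√(2 * a / |c| + 1), by positivity, ?_⟩
    rw [Real.sq_sqrt (by positivity), mul_one_div, div_le_iff₀ (by positivity)]
    have : |c| / 2 * (2 * a / |c| + 1) = a + |c| / 2 := by field_simp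
    linarith
  obtain ⟨J, hJ, hle⟩ := lintegral_potential_le hf hr
  set j := J.toReal
  obtain ⟨V, hVm, hVU, hV1, hV2⟩ := Measure.exists_subset_measure_lt_top (μ := volume)
    hUm (r := ENNReal.ofReal (2 * a * j / |c|)) (by rw [hU]; exact ENNReal.ofReal_lt_top)
  have h1 : ENNReal.ofReal |c| * volume V ≤ A * (J + ENNReal.ofReal (1 / r ^ 2) * volume V) := by
    refine le_trans (le_of_eq ?_) (hle V)
    rw [← setLIntegral_const]
    refine setLIntegral_congr_fun hVm fun x hx => ?_
    rw [h x (hVU hx), ← ofReal_norm, Real.norm_eq_abs]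
  have h2 := ENNReal.toReal_mono (by finiteness) h1
  rw [ENNReal.toReal_mul, ENNReal.toReal_mul, ENNReal.toReal_add hJ (by finiteness),
    ENNReal.toReal_mul, ENNReal.toReal_ofReal hc'.le, ENNReal.toReal_ofReal (by positivity)] at h2
  have h3 : 2 * a * j / |c| < (volume V).toReal :=
    (ENNReal.ofReal_lt_iff_lt_toReal (by positivity) hV2.ne).1 hV1
  rw [div_lt_iff₀ hc'] at h3
  have h4 : a * (1 / r ^ 2) * (volume V).toReal ≤ |c| / 2 * (volume V).toReal := by gcongr
  nlinarith

/-! ### Divergence-free sources -/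

/-- The distributional divergence of the vector measure with density `f` vanishes. -/
def IsDivFree (m : Measure R3) (f : R3 → R3) : Prop :=
  ∀ φ : R3 → ℝ, ContDiff ℝ ∞ φ → HasCompactSupport φ → ∫ y, fderiv ℝ φ y (f y) ∂m = 0

theorem integral_mul_inv_sq_le {ψ : R3 → ℝ} (hψ : Continuous ψ) (hs : HasCompactSupport ψ) :
    ∃ C : ℝ, ∀ y : R3, ∫ x, |ψ x| * (1 / ‖x - y‖ ^ 2) ≤ C := by
  obtain ⟨C, hC, h⟩ := lintegral_mul_inv_sq_le hψ hs
  refine ⟨C.toReal, fun y => ?_⟩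
  rw [integral_eq_lintegral_of_nonneg_ae (Eventually.of_forall fun x => by positivity)
    (integrable_mul_inv_sq hψ hs y).1]
  exact ENNReal.toReal_mono hC (h y)

/-- Pair the potential with `lap φ` and exchange integrals: the inner integral becomes a nonzero
multiple of the derivative of `φ` along `f y`. -/
theorem isDivFree_of_potential_eq_zero {m : Measure R3} [SFinite m] {f : R3 → R3}
    (hf : Integrable f m) (h : ∀ᵐ x, ∫ y, potentialKernel (x - y) (f y) ∂m = 0) :
    IsDivFree m f := by
  intro φ hφ hs
  have hl := (contDiff_lap hφ).continuous
  have hls := hasCompactSupport_lap hs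
  obtain ⟨C, hC⟩ := integral_mul_inv_sq_le hl hls
  have hle : ∀ x y, ‖lap φ x * potentialKernel (x - y) (f y)‖
      ≤ ‖f y‖ * (|lap φ x| * (1 / ‖x - y‖ ^ 2)) := fun x y => by
    rw [norm_mul, Real.norm_eq_abs, Real.norm_eq_abs, mul_left_comm]
    exact mul_le_mul_of_nonneg_left (abs_potentialKernel_le _ _) (abs_nonneg _)
  have hmeas : AEStronglyMeasurable
      (Function.uncurry fun x y => lap φ x * potentialKernel (x - y) (f y)) (volume.prod m) := by
    refine AEStronglyMeasurable.mul (hl.comp continuous_fst).aestronglyMeasurable ?_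
    exact (measurable_potentialKernel.comp_aemeasurable
      ((measurable_fst.sub measurable_snd).aemeasurable.prodMk
        hf.1.aemeasurable.comp_snd)).aestronglyMeasurable
  have hint : ∀ y, Integrable fun x => lap φ x * potentialKernel (x - y) (f y) := fun y => by
    refine ((integrable_mul_inv_sq hl hls y).const_mul ‖f y‖).mono' ?_
      (Eventually.of_forall fun x => hle x y)
    have := hl.measurable
    refine Measurable.aestronglyMeasurable ?_
    unfold potentialKernel
    fun_prop
  have hprod : Integrable (Function.uncurry fun x y => lap φ x * potentialKernel (x - y) (f y))
      (volume.prod m) := by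
    refine (integrable_prod_iff' hmeas).2 ⟨Eventually.of_forall hint, ?_⟩
    refine (hf.norm.mul_const C).mono' hmeas.prod_swap.norm.integral_prod_right' (Eventually.of_forall fun y => ?_)
    rw [Real.norm_of_nonneg (integral_nonneg fun x => norm_nonneg _)]
    calc ∫ x, ‖lap φ x * potentialKernel (x - y) (f y)‖
        ≤ ∫ x, ‖f y‖ * (|lap φ x| * (1 / ‖x - y‖ ^ 2)) :=
          integral_mono (hint y).norm ((integrable_mul_inv_sq hl hls y).const_mul _)
            fun x => hle x y
      _ = ‖f y‖ * ∫ x, |lap φ x| * (1 / ‖x - y‖ ^ 2) := integral_const_mul _ _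
      _ ≤ ‖f y‖ * C := by
        gcongr
        exact hC y
  have hswap := integral_integral_swap hprod
  have h0 : ∫ x, ∫ y, lap φ x * potentialKernel (x - y) (f y) ∂m = 0 := by
    refine integral_eq_zero_of_ae ?_
    filter_upwards [h] with x hx
    rw [integral_const_mul, hx, mul_zero]
    rfl
  rw [h0] at hswap
  simp only [integral_lap_mul_potentialKernel hφ hs, dirDeriv, integral_neg,
    integral_mul_const] at hswap
  have := newtonConstant_pos.ne'
  simpa [this] using hswap.symm

theorem isDivFree_of_isSlender {m : Measure R3} [SFinite m] {f : R3 → R3} (hf : Integrable f m)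
    {S : Set R3} (hS : IsSlender S) (hm : m Sᶜ = 0)
    (h : ∀ e, ∀ x ∉ S, ∫ y, fieldKernel e (x - y) (f y) ∂m = 0) : IsDivFree m f := by
  refine isDivFree_of_potential_eq_zero hf ?_
  have hae : ∀ᵐ x : R3, x ∈ Sᶜ := measure_eq_zero_iff_ae_notMem.1 hS.2.1
  filter_upwards [hae] with x hx
  refine potential_eq_zero_of_const hf
    hS.1.isOpen_compl.connectedComponentIn.measurableSet (hS.2.2 x hx) fun y hy => ?_
  exact eq_on_preconnected_of_locally_eq (F := fun x => ∫ y, potentialKernel (x - y) (f y) ∂m)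
    (fun z hz => potential_locally_eq hf hS.1 hm h hz)
    isPreconnected_connectedComponentIn (connectedComponentIn_subset _ _)
    (mem_connectedComponentIn hx) hy

end Magnetostatics
end

noncomputable section
namespace Magnetostatics
open scoped InnerProductSpace ContDiff Manifold Topology
open Filter

/-! ### Consequences of vanishing divergence -/

theorem exists_norm_fderiv_le {φ : R3 → ℝ} (hφ : ContDiff ℝ ∞ φ) (hs : HasCompactSupport φ) :
    ∃ C, ∀ y, ‖fderiv ℝ φ y‖ ≤ C :=
  (hφ.continuous_fderiv (by simp)).bounded_above_of_compact_support (hs.fderiv ℝ)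

/-- Test with χφ, where χ is 1 on `A` and 0 on `B`. No term in the gradient of χ survives, since χ
attains its maximum on `A` and its minimum on `B`. -/
theorem IsDivFree.restrict {m : Measure R3} {f : R3 → R3} (hd : IsDivFree m f) {A B : Set R3}
    (hA : IsClosed A) (hB : IsClosed B) (hAB : Disjoint A B) (hm : m (A ∪ B)ᶜ = 0) :
    IsDivFree (m.restrict A) f := by
  intro φ hφ hs
  obtain ⟨χ, hχB, hχA, hχ⟩ := exists_contMDiffMap_zero_one_of_isClosed (n := ⊤) 𝓘(ℝ, R3) hB hA
    hAB.symm
  have hχs : ContDiff ℝ ∞ χ := χ.contMDiff.contDiff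
  have hχd := fun y => hχs.differentiable (by simp) y
  have hφd := fun y => hφ.differentiable (by simp) y
  have hdA : ∀ y ∈ A, fderiv ℝ χ y = 0 := fun y hy => by
    refine IsLocalMax.fderiv_eq_zero (Eventually.of_forall fun z => ?_)
    rw [hχA hy]
    exact (hχ z).2
  have hdB : ∀ y ∈ B, fderiv ℝ χ y = 0 := fun y hy => by
    refine IsLocalMin.fderiv_eq_zero (Eventually.of_forall fun z => ?_)
    rw [hχB hy]
    exact (hχ z).1
  have hmul : ∀ y, fderiv ℝ (fun y => χ y * φ y) y = χ y • fderiv ℝ φ y + φ y • fderiv ℝ χ y :=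
    fun y => fderiv_fun_mul (hχd y) (hφd y)
  have hkey := hd (fun y => χ y * φ y) (hχs.mul hφ) hs.mul_left
  have hae : ∀ᵐ y ∂m, y ∈ A ∪ B := hm
  rw [← hkey, ← integral_indicator hA.measurableSet]
  refine integral_congr_ae ?_
  filter_upwards [hae] with y hy
  rw [hmul]
  by_cases hyA : y ∈ A
  · rw [Set.indicator_of_mem hyA, hdA y hyA, hχA hyA]
    simp
  · have hyB := hy.resolve_left hyA
    rw [Set.indicator_of_notMem hyA, hdB y hyB, hχB hyB]
    simp

/-- Extends the class of test functions to linear growth with bounded gradient: the gradient of the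
cutoff at scale R is O(1/R) and is supported where φ is O(R). -/
theorem IsDivFree.integral_eq_zero_of_bounded {m : Measure R3} {f : R3 → R3}
    (hd : IsDivFree m f) (hf : Integrable f m) {φ : R3 → ℝ} (hφ : ContDiff ℝ ∞ φ) {C : ℝ}
    (hC : ∀ y, |φ y| ≤ C * (1 + ‖y‖)) (hC' : ∀ y, ‖fderiv ℝ φ y‖ ≤ C) :
    ∫ y, fderiv ℝ φ y (f y) ∂m = 0 := by
  have hC0 : 0 ≤ C := (norm_nonneg _).trans (hC' 0)
  let χ : ContDiffBump (0 : R3) := ⟨1, 2, one_pos, one_lt_two⟩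
  have hχ : ContDiff ℝ ∞ χ := χ.contDiff
  obtain ⟨M, hM⟩ := exists_norm_fderiv_le hχ χ.hasCompactSupport
  have hM0 : 0 ≤ M := (norm_nonneg _).trans (hM 0)
  have hφd := fun y => hφ.differentiable (by simp) y
  have hsm : ∀ R : ℝ, ContDiff ℝ ∞ fun y => χ (R⁻¹ • y) * φ y := fun R =>
    (hχ.comp (contDiff_const_smul _)).mul hφ
  have hder : ∀ R : ℝ, ∀ y, fderiv ℝ (fun y => χ (R⁻¹ • y) * φ y) y
      = χ (R⁻¹ • y) • fderiv ℝ φ y + φ y • R⁻¹ • fderiv ℝ χ (R⁻¹ • y) := fun R y => by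
    have hχR : DifferentiableAt ℝ (fun y => χ (R⁻¹ • y)) y :=
      (hχ.comp (contDiff_const_smul R⁻¹)).differentiable (by simp) y
    rw [fderiv_fun_mul hχR (hφd y)]
    congr 2
    exact fderiv_comp_smul _
  have hlim : Tendsto (fun R : ℝ => ∫ y, fderiv ℝ (fun y => χ (R⁻¹ • y) * φ y) y (f y) ∂m) atTop
      (𝓝 (∫ y, fderiv ℝ φ y (f y) ∂m)) := by
    -- For R ≥ 1 and ‖y‖ ≤ 2R one has |φ y| ≤ C(1 + 2R) ≤ 3CR, against a cutoff gradient of at most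
    -- M/R.
    refine tendsto_integral_filter_of_dominated_convergence (fun y => (C + 3 * C * M) * ‖f y‖) ?_ ?_
      (hf.norm.const_mul _) ?_
    · refine Eventually.of_forall fun R => ?_
      exact (ContinuousLinearMap.id ℝ (R3 →L[ℝ] ℝ)).aestronglyMeasurable_comp₂
        ((hsm R).continuous_fderiv (by simp)).aestronglyMeasurable hf.1
    · filter_upwards [eventually_ge_atTop 1] with R hR
      refine Eventually.of_forall fun y => ((fderiv ℝ _ y).le_opNorm _).trans ?_
      gcongr
      rw [hder]
      have hR0 : 0 < R := one_pos.trans_le hR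
      refine (norm_add_le _ _).trans (add_le_add ?_ ?_)
      · rw [norm_smul, Real.norm_of_nonneg χ.nonneg]
        exact (mul_le_of_le_one_left (norm_nonneg _) χ.le_one).trans (hC' y)
      · rw [norm_smul, norm_smul, Real.norm_eq_abs, norm_inv, Real.norm_of_nonneg hR0.le]
        by_cases hy : ‖y‖ ≤ 2 * R
        · have h1 : |φ y| ≤ 3 * C * R := (hC y).trans (by nlinarith)
          calc |φ y| * (R⁻¹ * ‖fderiv ℝ χ (R⁻¹ • y)‖) ≤ 3 * C * R * (R⁻¹ * M) := by
                gcongr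
                exact hM _
            _ = _ := by field_simp
        · have h0 : fderiv ℝ χ (R⁻¹ • y) = 0 := by
            refine image_eq_zero_of_notMem_tsupport fun h => hy ?_
            have h2 := tsupport_fderiv_subset ℝ h
            rw [χ.tsupport_eq, mem_closedBall_zero_iff, norm_smul, norm_inv,
              Real.norm_of_nonneg hR0.le, inv_mul_le_iff₀ hR0] at h2
            linarith
          rw [h0]
          simp only [norm_zero, mul_zero]
          positivity
    · refine Eventually.of_forall fun y => tendsto_const_nhds.congr' ?_
      filter_upwards [eventually_gt_atTop ‖y‖] with R hR
      have hR0 : 0 < R := (norm_nonneg _).trans_lt hR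
      have he : (fun y => χ (R⁻¹ • y) * φ y) =ᶠ[𝓝 y] φ := by
        filter_upwards [continuous_norm.continuousAt.eventually_lt_const hR] with z hz
        rw [χ.one_of_mem_closedBall, one_mul]
        rw [mem_closedBall_zero_iff, norm_smul, norm_inv, Real.norm_of_nonneg hR0.le,
          inv_mul_le_iff₀ hR0]
        linarith
      rw [he.fderiv_eq]
  refine tendsto_nhds_unique hlim (tendsto_const_nhds.congr' ?_)
  filter_upwards [eventually_gt_atTop 0] with R hR
  refine (hd _ (hsm R) (HasCompactSupport.mul_right ?_)).symm
  exact χ.hasCompactSupport.comp_smul (inv_ne_zero hR.ne')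

theorem IsDivFree.moment_eq_zero {m : Measure R3} {f : R3 → R3} (hd : IsDivFree m f)
    (hf : Integrable f m) : ∫ y, f y ∂m = 0 := by
  refine ext_inner_left ℝ fun v => ?_
  rw [inner_zero_right, ← integral_inner hf]
  have hfd : ∀ y, fderiv ℝ (fun y : R3 => ⟪v, y⟫_ℝ) y = innerSL ℝ v := fun y =>
    (innerSL ℝ v).fderiv
  have := hd.integral_eq_zero_of_bounded hf (φ := fun y => ⟪v, y⟫_ℝ) (C := ‖v‖)
    (innerSL ℝ v).contDiff
    (fun y => (abs_real_inner_le_norm v y).trans (by gcongr; linarith)) fun y => by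
      rw [hfd, innerSL_apply_norm]
  simpa [hfd] using this

/-! ### The field of a divergence-free source -/

theorem fieldKernel_comm (e z w : R3) : fieldKernel e z w = fieldKernel w z e := by
  unfold fieldKernel
  rw [real_inner_comm e w]
  ring

theorem contDiffAt_potentialKernel {x y : R3} (h : x ≠ y) (e : R3) :
    ContDiffAt ℝ ∞ (fun y => potentialKernel (x - y) e) y := by
  have hz : x - y ≠ 0 := sub_ne_zero.2 h
  have h1 : ContDiffAt ℝ ∞ (fun y : R3 => x - y) y := by fun_prop
  exact (h1.inner ℝ contDiffAt_const).div ((h1.norm ℝ hz).pow 3)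
    (pow_ne_zero 3 (norm_ne_zero_iff.2 hz))

theorem fderiv_potentialKernel {x y : R3} (h : x ≠ y) (e v : R3) :
    fderiv ℝ (fun y => potentialKernel (x - y) e) y v = -fieldKernel e (x - y) v := by
  refine fderiv_eq_of_hasDerivAt_line
    ((contDiffAt_potentialKernel h e).differentiableAt (by simp)) ?_
  have h1 := hasDerivAt_potentialKernel (sub_ne_zero.2 h) (-v) e
  rw [fieldKernel_comm e]
  refine (h1.congr_of_eventuallyEq (Eventually.of_forall fun t => ?_)).congr_deriv ?_
  · simp only
    congr 1
    rw [smul_neg]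
    abel
  · simp only [fieldKernel, inner_neg_left, inner_neg_right]
    ring

/-- By symmetry of the kernel in `e` and the moment, the integrand is minus the derivative along `f
y` of the potential at `x` of a dipole `e` placed at `y`. That potential, cut off near `x`, is an
admissible test function. -/
theorem IsDivFree.field_eq_zero {m : Measure R3} {f : R3 → R3} (hd : IsDivFree m f)
    (hf : Integrable f m) {T : Set R3} (hT : IsClosed T) (hm : m Tᶜ = 0) {x : R3} (hx : x ∉ T)
    (e : R3) : ∫ y, fieldKernel e (x - y) (f y) ∂m = 0 := by
  obtain ⟨δ, hδ, h⟩ := exists_le_norm_sub_of_notMem hT hx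
  -- The cutoff only acts within δ/2 of `x`, while `T` stays at distance at least δ.
  let χ : ContDiffBump x := ⟨δ / 4, δ / 2, by positivity, by linarith⟩
  set φ : R3 → ℝ := fun y => (1 - χ y) * potentialKernel (x - y) e with hφ
  have hnear : ∀ y, ‖x - y‖ < δ / 4 → φ =ᶠ[𝓝 y] fun _ => 0 := fun y hy => by
    have hc : Continuous fun z : R3 => ‖x - z‖ := by fun_prop
    filter_upwards [hc.continuousAt.eventually_lt_const hy] with z hz
    simp only [hφ]
    rw [χ.one_of_mem_closedBall, sub_self, zero_mul]
    rw [mem_closedBall_iff_norm, norm_sub_rev]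
    exact hz.le
  have hfar : ∀ y, δ / 2 < ‖x - y‖ → φ =ᶠ[𝓝 y] fun y => potentialKernel (x - y) e :=
    fun y hy => by
    have hc : Continuous fun z : R3 => ‖x - z‖ := by fun_prop
    filter_upwards [hc.continuousAt.eventually_const_lt hy] with z hz
    simp only [hφ]
    rw [χ.zero_of_le_dist, sub_zero, one_mul]
    rw [dist_eq_norm, norm_sub_rev]
    exact hz.le
  have hsm : ContDiff ℝ ∞ φ := contDiff_iff_contDiffAt.2 fun y => by
    by_cases hy : ‖x - y‖ < δ / 4
    · exact contDiffAt_const.congr_of_eventuallyEq (hnear y hy)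
    · have hxy : x ≠ y := fun he => hy (by rw [he, sub_self, norm_zero]; positivity)
      exact (contDiffAt_const.sub χ.contDiffAt).mul (contDiffAt_potentialKernel hxy e)
  have hfd : ∀ y, δ / 2 < ‖x - y‖ → ∀ v, fderiv ℝ φ y v = -fieldKernel e (x - y) v :=
    fun y hy v => by
    have hxy : x ≠ y := fun he => by
      rw [he, sub_self, norm_zero] at hy
      linarith
    rw [(hfar y hy).fderiv_eq, fderiv_potentialKernel hxy]
  obtain ⟨M, hM⟩ := (isCompact_closedBall x δ).exists_bound_of_continuousOn
    (hsm.continuous_fderiv (by simp)).continuousOn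
  have hb1 : ∀ y, |φ y| ≤ ‖e‖ * (1 / (δ / 4) ^ 2) := fun y => by
    by_cases hy : ‖x - y‖ < δ / 4
    · rw [(hnear y hy).self_of_nhds, abs_zero]
      positivity
    · rw [not_lt] at hy
      rw [hφ]
      simp only [abs_mul]
      have h1 : |1 - χ y| ≤ 1 := by
        rw [abs_le]
        constructor <;> linarith [χ.nonneg (x := y), χ.le_one (x := y)]
      refine (mul_le_of_le_one_left (abs_nonneg _) h1).trans ((abs_potentialKernel_le _ _).trans ?_)
      gcongr
  have hb2 : ∀ y, ‖fderiv ℝ φ y‖ ≤ max M (4 * ‖e‖ / δ ^ 3) := fun y => by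
    by_cases hy : ‖x - y‖ ≤ δ
    · exact (hM y (by rwa [mem_closedBall_iff_norm, norm_sub_rev])).trans (le_max_left _ _)
    · rw [not_le] at hy
      refine le_trans ?_ (le_max_right _ _)
      refine ContinuousLinearMap.opNorm_le_bound _ (by positivity) fun v => ?_
      rw [hfd y (by linarith), norm_neg, Real.norm_eq_abs, div_mul_eq_mul_div]
      refine (abs_fieldKernel_le _ _ _).trans ?_
      gcongr
  have hkey := hd.integral_eq_zero_of_bounded hf hsm
    (C := max (‖e‖ * (1 / (δ / 4) ^ 2)) (max M (4 * ‖e‖ / δ ^ 3)))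
    (fun y => (hb1 y).trans ((le_max_left _ _).trans (le_mul_of_one_le_right
      (le_max_of_le_left (by positivity)) (by linarith [norm_nonneg y]))))
    fun y => (hb2 y).trans (le_max_right _ _)
  have hae : ∀ᵐ y ∂m, y ∈ T := hm
  rw [← neg_eq_zero, ← integral_neg, ← hkey]
  refine integral_congr_ae ?_
  filter_upwards [hae] with y hy
  exact (hfd y (by linarith [h y hy]) (f y)).symm

/-- Vanishing divergence makes the integral of a translate φ(· + tv) against the scalar density
independent of t. As t → ∞ the compact support of φ leaves every point, so by dominated convergence
the constant is zero. -/
theorem IsDivFree.ae_eq_zero_of_direction {m : Measure R3} [IsFiniteMeasure m] {f : R3 → R3}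
    (hd : IsDivFree m f) (hf : Integrable f m) {v : R3} (hv : ‖v‖ = 1)
    (hfv : ∀ᵐ y ∂m, f y = ⟪v, f y⟫_ℝ • v) : ∀ᵐ y ∂m, f y = 0 := by
  have hs : Integrable (fun y => ⟪v, f y⟫_ℝ) m := hf.const_inner v
  have hv0 : v ≠ 0 := fun h => by simp [h] at hv
  have hzero : ∀ᵐ y ∂m, ⟪v, f y⟫_ℝ = 0 := by
    refine ae_eq_zero_of_integral_contDiff_smul_eq_zero hs.locallyIntegrable fun φ hφ hφs => ?_
    have hφd := fun y => hφ.differentiable (by simp) y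
    obtain ⟨M, hM⟩ := exists_norm_fderiv_le hφ hφs
    obtain ⟨K, hK⟩ := hφ.continuous.bounded_above_of_compact_support hφs
    set g : ℝ → ℝ := fun t => ∫ y, φ (y + t • v) • ⟪v, f y⟫_ℝ ∂m with hg
    have hmeas : ∀ t : ℝ, AEStronglyMeasurable (fun y => φ (y + t • v) • ⟪v, f y⟫_ℝ) m := fun t => by
      have : Continuous fun y => φ (y + t • v) := hφ.continuous.comp (by fun_prop)
      exact this.aestronglyMeasurable.smul hs.1
    have hbd : ∀ t : ℝ, ∀ y, ‖φ (y + t • v) • ⟪v, f y⟫_ℝ‖ ≤ K * ‖⟪v, f y⟫_ℝ‖ := fun t y => by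
      rw [norm_smul]
      gcongr
      exact hK _
    have hderiv : ∀ t, HasDerivAt g 0 t := by
      intro t
      have hsh : ContDiff ℝ ∞ fun y => φ (y + t • v) := hφ.comp (by fun_prop)
      have key := hasDerivAt_integral_of_dominated_loc_of_deriv_le (μ := m) (x₀ := t)
        (F := fun t y => φ (y + t • v) • ⟪v, f y⟫_ℝ)
        (F' := fun t y => fderiv ℝ φ (y + t • v) v • ⟪v, f y⟫_ℝ)
        (bound := fun y => M * ‖⟪v, f y⟫_ℝ‖) (s := Set.univ) univ_mem
        (Eventually.of_forall hmeas) ((hs.norm.const_mul K).mono' (hmeas t)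
          (Eventually.of_forall (hbd t))) ?_ ?_ (hs.norm.const_mul M) ?_
      · have h0 := hd _ hsh (hφs.comp_homeomorph (Homeomorph.addRight (t • v)))
        refine key.2.congr_deriv ?_
        rw [← h0]
        refine integral_congr_ae (hfv.mono fun y hy => ?_)
        simp only
        rw [fderiv_comp_add_right]
        conv_rhs => rw [hy]
        rw [map_smul, smul_eq_mul, smul_eq_mul, mul_comm]
      · have : Continuous fun y => fderiv ℝ φ (y + t • v) v :=
          ((hφ.continuous_fderiv (by simp)).comp (by fun_prop)).clm_apply continuous_const
        exact this.aestronglyMeasurable.smul hs.1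
      · refine Eventually.of_forall fun y t _ => ?_
        rw [norm_smul]
        gcongr
        refine ((fderiv ℝ φ _).le_opNorm v).trans ?_
        rw [hv, mul_one]
        exact hM _
      · refine Eventually.of_forall fun y t _ => HasDerivAt.smul_const ?_ _
        have h1 : HasDerivAt (fun t : ℝ => y + t • v) v t := by
          simpa using ((hasDerivAt_id t).smul_const v).const_add y
        exact (hφd _).hasFDerivAt.comp_hasDerivAt t h1
    have hlim : Tendsto g atTop (𝓝 (∫ y, (0 : ℝ) ∂m)) := by
      refine tendsto_integral_filter_of_dominated_convergence (fun y => K * ‖⟪v, f y⟫_ℝ‖)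
        (Eventually.of_forall hmeas)
        (Eventually.of_forall fun t => Eventually.of_forall (hbd t)) (hs.norm.const_mul K)
        (Eventually.of_forall fun y => ?_)
      obtain ⟨r, hr⟩ := hφs.isCompact.isBounded.exists_norm_le
      refine tendsto_const_nhds.congr' ?_
      filter_upwards [eventually_gt_atTop (r + ‖y‖), eventually_ge_atTop 0] with t ht ht0
      refine (smul_eq_zero_of_left (image_eq_zero_of_notMem_tsupport fun hmem => ?_) _).symm
      have h1 := hr _ hmem
      have h2 := norm_sub_norm_le (t • v) (-y)
      rw [norm_smul, hv, mul_one, Real.norm_of_nonneg ht0, norm_neg, sub_neg_eq_add,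
        add_comm (t • v)] at h2
      linarith
    have hconst : ∀ t, g t = g 0 := fun t =>
      is_const_of_deriv_eq_zero (fun t => (hderiv t).differentiableAt) (fun t => (hderiv t).deriv) t 0
    have h0 := tendsto_nhds_unique (hlim.congr hconst) tendsto_const_nhds
    simpa [hg] using h0.symm
  filter_upwards [hfv, hzero] with y hy hy0
  rw [hy, hy0, zero_smul]

end Magnetostatics
end

noncomputable section
namespace Magnetostatics
open scoped InnerProductSpace ContDiff Topology

/-! ### Separation of silent sources -/

theorem variation_compl_eq_zero {μ : Magnetization} {S : Set R3} (h : μ ∈ magnetizationsOn S) :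
    μ.variation Sᶜ = 0 :=
  measure_mono_null (Set.compl_subset_compl.2 h) Measure.measure_compl_support

theorem isDivFree_restrict_of_isSlender {n : ℕ} {T : Fin n → Set R3} (hT : ∀ i, IsClosed (T i))
    (hd : ∀ i j, i ≠ j → Disjoint (T i) (T j)) (hS : IsSlender (⋃ i, T i)) {σ : Magnetization}
    (hσ : σ.variation (⋃ i, T i)ᶜ = 0) (h : ∀ x ∉ ⋃ i, T i, magneticField σ x = 0) (i : Fin n) :
    IsDivFree (σ.variation.restrict (T i)) (polarDensity σ) := by
  have hc : -magneticConstant ≠ 0 := by norm_num [magneticConstant]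
  have hdiv : IsDivFree σ.variation (polarDensity σ) := by
    refine isDivFree_of_isSlender (integrable_polarDensity σ) hS hσ fun e x hx => ?_
    have := inner_magneticField hS.1 hσ hx e
    rw [h x hx, inner_zero_right] at this
    exact (mul_eq_zero.1 this.symm).resolve_left hc
  refine hdiv.restrict (B := ⋃ j : {j // j ≠ i}, T j) (hT i)
    (isClosed_iUnion_of_finite fun j => hT j)
    (Set.disjoint_iUnion_right.2 fun j => hd i j j.2.symm) ?_
  refine measure_mono_null (Set.compl_subset_compl.2 (Set.iUnion_subset fun j => ?_)) hσ
  by_cases hj : j = i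
  · exact hj ▸ Set.subset_union_left
  · exact (Set.subset_iUnion (fun j : {j // j ≠ i} => T j) ⟨j, hj⟩).trans Set.subset_union_right

/-- The fields of disjoint closed pieces cannot cancel each other: harmonic gluing shows this in the
compact case, locality of the divergence in the slender one. -/
theorem silent_restrict {n : ℕ} {T : Fin n → Set R3} (hT : ∀ i, IsClosed (T i))
    (hd : ∀ i j, i ≠ j → Disjoint (T i) (T j))
    (hS : IsCompact (⋃ i, T i) ∨ IsSlender (⋃ i, T i)) {σ : Magnetization}
    (hσ : σ.variation (⋃ i, T i)ᶜ = 0) (h : ∀ x ∉ ⋃ i, T i, magneticField σ x = 0) (i : Fin n) :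
    (∀ x ∉ T i, magneticField (σ.restrict (T i)) x = 0) ∧ σ (T i) = 0 := by
  have hf := integrable_polarDensity σ
  have hclosed : IsClosed (⋃ i, T i) := isClosed_iUnion_of_finite hT
  rw [apply_eq_setIntegral_polarDensity σ (hT i).measurableSet]
  rcases hS with hK | hS
  · have hTi : ∀ i, IsCompact (T i) := fun i =>
      hK.of_isClosed_subset (hT i) (Set.subset_iUnion T i)
    have hc : -magneticConstant ≠ 0 := by norm_num [magneticConstant]
    have hfield : ∀ e, ∀ x ∉ T i,
        ∫ y in T i, fieldKernel e (x - y) (polarDensity σ y) ∂σ.variation = 0 := by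
      refine fun e x hx => field_eq_zero_of_isCompact hTi hd hσ hf e (fun x hx => ?_) i hx
      have := inner_magneticField hclosed hσ hx e
      rw [h x hx, inner_zero_right] at this
      exact (mul_eq_zero.1 this.symm).resolve_left hc
    exact ⟨fun x hx => (magneticField_restrict_eq_zero_iff (hT i) hx).2 fun e => hfield e x hx,
      moment_eq_zero_of_isCompact (hTi i) (restrict_compl_self _ (hT i)) hf.integrableOn hfield⟩
  · have hdiv := isDivFree_restrict_of_isSlender hT hd hS hσ h i
    exact ⟨fun x hx => (magneticField_restrict_eq_zero_iff (hT i) hx).2 fun e =>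
      hdiv.field_eq_zero hf.integrableOn (hT i) (restrict_compl_self _ (hT i)) hx e,
      hdiv.moment_eq_zero hf.integrableOn⟩

/-! ### Total variation and direction on the pieces -/

theorem variation_restrict_real_univ (μ : Magnetization) {T : Set R3} (hT : MeasurableSet T) :
    (μ.restrict T).variation.real Set.univ = μ.variation.real T := by
  rw [VectorMeasure.variation_restrict hT, measureReal_restrict_apply_univ]

theorem restrict_univ_apply (μ : Magnetization) {T : Set R3} (hT : MeasurableSet T) :
    μ.restrict T Set.univ = μ T := by
  rw [VectorMeasure.restrict_apply _ hT MeasurableSet.univ, Set.univ_inter]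

theorem tvNorm_eq_sum {n : ℕ} {T : Fin n → Set R3} (hT : ∀ i, IsClosed (T i))
    (hd : ∀ i j, i ≠ j → Disjoint (T i) (T j)) {μ : Magnetization}
    (hμ : μ.variation (⋃ i, T i)ᶜ = 0) :
    tvNorm μ = ENNReal.ofReal (∑ i, μ.variation.real (T i)) := by
  have h1 : μ.variation Set.univ = μ.variation (⋃ i, T i) :=
    (measure_eq_measure_of_null_sdiff (Set.subset_univ _)
      (by rwa [← Set.compl_eq_univ_sdiff])).symm
  rw [tvNorm, h1, measure_iUnion (fun i j hij => hd i j hij) fun i => (hT i).measurableSet,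
    tsum_fintype, ENNReal.ofReal_sum_of_nonneg fun i _ => measureReal_nonneg]
  simp

theorem HasDirection.variation_eq_norm {μ : Magnetization} {v : R3} {T : Set R3}
    (hT : MeasurableSet T) (h : HasDirection (μ.restrict T) v) :
    μ.variation.real T = ‖μ T‖ := by
  have h1 := hasDirection_iff.1 h Set.univ MeasurableSet.univ
  rw [variation_restrict_real_univ μ hT, restrict_univ_apply μ hT] at h1
  rcases eq_or_ne (μ.variation.real T) 0 with h0 | h0
  · rw [h1, h0, zero_smul, norm_zero]
  · have hv := norm_eq_one_of_hasDirection h (by rwa [variation_restrict_real_univ μ hT])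
    rw [h1, norm_smul, hv, mul_one, Real.norm_of_nonneg measureReal_nonneg]

/-- A uni-directional magnetization and another one with the same total moment have the same total
variation exactly when they have the same direction. -/
theorem variation_eq_iff_isUniDirectionalSame {μ ν : Magnetization} {T : Set R3}
    (hT : MeasurableSet T) (hμ : IsUniDirectional (μ.restrict T)) (hμν : ν T = μ T) :
    μ.variation.real T = ν.variation.real T ↔
      IsUniDirectionalSame (μ.restrict T) (ν.restrict T) := by
  constructor
  · intro h
    obtain ⟨v, hv⟩ := hμ
    rcases eq_or_ne (μ.variation.real T) 0 with h0 | h0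
    · exact ⟨v, hv, hasDirection_of_variation_eq_zero
        (by rw [variation_restrict_real_univ ν hT, ← h, h0]) v⟩
    · have hv1 := norm_eq_one_of_hasDirection hv (by rwa [variation_restrict_real_univ μ hT])
      refine ⟨v, hv, hasDirection_of_inner_eq hv1 ?_⟩
      have h1 := hasDirection_iff.1 hv Set.univ MeasurableSet.univ
      rw [variation_restrict_real_univ μ hT, restrict_univ_apply μ hT] at h1
      rw [variation_restrict_real_univ ν hT, restrict_univ_apply ν hT, hμν, h1,
        real_inner_smul_right, real_inner_self_eq_norm_sq, hv1, ← h]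
      ring
  · rintro ⟨v, h1, h2⟩
    rw [h1.variation_eq_norm hT, h2.variation_eq_norm hT, hμν]

theorem polarDensity_ae_eq_zero_of_isDivFree {μ ν : Magnetization} {T : Set R3} (hT : MeasurableSet T)
    (h : IsUniDirectionalSame (μ.restrict T) (ν.restrict T))
    (hd : IsDivFree ((ν - μ).variation.restrict T) (polarDensity (ν - μ))) :
    ∀ᵐ y ∂(ν - μ).variation.restrict T, polarDensity (ν - μ) y = 0 := by
  obtain ⟨v, hμ, hν⟩ := h
  have hf : Integrable (polarDensity (ν - μ)) ((ν - μ).variation.restrict T) :=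
    (integrable_polarDensity (ν - μ)).integrableOn
  have hσ : ∀ B, MeasurableSet B → ∃ c : ℝ,
      ∫ y in B, polarDensity (ν - μ) y ∂(ν - μ).variation.restrict T = c • v := fun B hB => by
    have e1 := hasDirection_iff.1 hμ B hB
    have e2 := hasDirection_iff.1 hν B hB
    rw [VectorMeasure.restrict_apply _ hT hB] at e1 e2
    refine ⟨(ν.restrict T).variation.real B - (μ.restrict T).variation.real B, ?_⟩
    rw [Measure.restrict_restrict hB, ← apply_eq_setIntegral_polarDensity _ (hB.inter hT),
      sub_smul, ← e1, ← e2]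
    rfl
  -- A direction need not be a unit vector, since a zero measure has every direction. Taking u = 0
  -- covers v = 0, and otherwise u is `v` normalized.
  have key : ∀ u : R3, (∀ c : ℝ, ⟪u, c • v⟫_ℝ • u = c • v) →
      ∀ᵐ y ∂(ν - μ).variation.restrict T,
        polarDensity (ν - μ) y = ⟪u, polarDensity (ν - μ) y⟫_ℝ • u := fun u hu => by
    refine hf.ae_eq_of_forall_setIntegral_eq _ _ ((hf.const_inner u).smul_const u) fun B hB _ => ?_
    rw [integral_smul_const, integral_inner hf.integrableOn]
    obtain ⟨c, hc⟩ := hσ B hB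
    rw [hc, hu]
  rcases eq_or_ne v 0 with rfl | hv0
  · simpa using key 0 (by simp)
  · have hn := norm_ne_zero_iff.2 hv0
    refine hd.ae_eq_zero_of_direction hf (v := ‖v‖⁻¹ • v) (norm_smul_inv_norm hv0)
      (key _ fun c => ?_)
    rw [real_inner_smul_left, real_inner_smul_right, real_inner_self_eq_norm_sq, smul_smul]
    congr 1
    field_simp

end Magnetostatics
end

/-! ### The main theorem -/

theorem mainTheorem3 (n : ℕ) (S : Set Magnetostatics.R3) (T : Fin n → Set Magnetostatics.R3)
    (hT_closed : ∀ i, IsClosed (T i))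
    (hT_disjoint : ∀ i j, i ≠ j → Disjoint (T i) (T j))
    (hS : S = ⋃ i, T i)
    (hS_type : IsCompact S ∨ Magnetostatics.IsSlender S)
    (μ : Magnetostatics.Magnetization) (hμ : μ ∈ Magnetostatics.magnetizationsOn S)
    (hμ_uni : ∀ i, Magnetostatics.IsUniDirectional (μ.restrict (T i)))
    (ν : Magnetostatics.Magnetization) (hν : ν ∈ Magnetostatics.magnetizationsOn S)
    (hμν : Magnetostatics.SEquivalent S ν μ) :
    (∀ i, Magnetostatics.SEquivalent (T i) (ν.restrict (T i)) (μ.restrict (T i))) ∧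
    Magnetostatics.tvNorm μ ≤ Magnetostatics.tvNorm ν ∧
    (Magnetostatics.tvNorm μ = Magnetostatics.tvNorm ν ↔
      ∀ i, Magnetostatics.IsUniDirectionalSame (μ.restrict (T i)) (ν.restrict (T i))) ∧
    (Magnetostatics.IsSlender S → Magnetostatics.tvNorm μ = Magnetostatics.tvNorm ν → μ = ν) := by
  open Magnetostatics in
  subst hS
  have hclosed : IsClosed (⋃ i, T i) := isClosed_iUnion_of_finite hT_closed
  have hμ0 := variation_compl_eq_zero hμ
  have hν0 := variation_compl_eq_zero hν
  have hσ0 : (ν - μ).variation (⋃ i, T i)ᶜ = 0 := by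
    refine le_antisymm ((VectorMeasure.variation_sub_le _).trans ?_) zero_le
    rw [Measure.add_apply, hμ0, hν0, add_zero]
  have hfield : ∀ x ∉ ⋃ i, T i, magneticField (ν - μ) x = 0 := fun x hx => by
    rw [magneticField_sub hclosed hν0 hμ0 hx, hμν x hx, sub_self]
  have hsilent := silent_restrict hT_closed hT_disjoint hS_type hσ0 hfield
  have hmoment : ∀ i, ν (T i) = μ (T i) := fun i => sub_eq_zero.1 (hsilent i).2
  have hle : ∀ i, μ.variation.real (T i) ≤ ν.variation.real (T i) := fun i => by
    obtain ⟨v, hv⟩ := hμ_uni i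
    rw [hv.variation_eq_norm (hT_closed i).measurableSet, ← hmoment i]
    exact norm_apply_le ν (T i)
  have hμtv := tvNorm_eq_sum hT_closed hT_disjoint hμ0
  have hνtv := tvNorm_eq_sum hT_closed hT_disjoint hν0
  have heq : tvNorm μ = tvNorm ν ↔
      ∀ i, IsUniDirectionalSame (μ.restrict (T i)) (ν.restrict (T i)) := by
    rw [hμtv, hνtv, ENNReal.ofReal_eq_ofReal_iff
      (Finset.sum_nonneg fun i _ => measureReal_nonneg)
      (Finset.sum_nonneg fun i _ => measureReal_nonneg),
      Finset.sum_eq_sum_iff_of_le fun i _ => hle i]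
    simp only [Finset.mem_univ, forall_true_left]
    exact forall_congr' fun i => variation_eq_iff_isUniDirectionalSame
      (hT_closed i).measurableSet (hμ_uni i) (hmoment i)
  refine ⟨fun i x hx => ?_, ?_, heq, fun hS htv => ?_⟩
  · have h0 : ∀ ρ : Magnetization, (ρ.restrict (T i)).variation (T i)ᶜ = 0 := fun ρ => by
      rw [VectorMeasure.variation_restrict (hT_closed i).measurableSet]
      exact restrict_compl_self _ (hT_closed i)
    rw [← sub_eq_zero, ← magneticField_sub (hT_closed i) (h0 ν) (h0 μ) hx,
      ← VectorMeasure.restrict_sub]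
    exact (hsilent i).1 x hx
  · rw [hμtv, hνtv]
    exact ENNReal.ofReal_le_ofReal (Finset.sum_le_sum fun i _ => hle i)
  · have hdir := heq.1 htv
    have hae : ∀ᵐ y ∂(ν - μ).variation, polarDensity (ν - μ) y = 0 := by
      have h1 : ∀ᵐ y ∂(ν - μ).variation, y ∈ ⋃ i, T i := hσ0
      rw [← Measure.restrict_eq_self_of_ae_mem h1, ae_restrict_iUnion_iff]
      exact fun i => polarDensity_ae_eq_zero_of_isDivFree (hT_closed i).measurableSet (hdir i)
        (isDivFree_restrict_of_isSlender hT_closed hT_disjoint hS hσ0 hfield i)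
    -- The polar density is zero and has norm one almost everywhere, so the variation charges
    -- nothing.
    have h2 : (ν - μ).variation = 0 := by
      rw [← ae_eq_bot, ← Filter.eventually_false_iff_eq_bot]
      filter_upwards [hae, norm_polarDensity (ν - μ)] with y hy hy1
      simp [hy] at hy1
    exact (sub_eq_zero.1 (VectorMeasure.variation_eq_zero.1 h2)).symm
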